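/- Notation. Let $n\ge 1$. For a measurable $p(\cdot):\mathbb R^n\to(0,\infty)$ with $p_+=\operatorname{ess\,sup}p<\infty$ and a measurable $h$ put $\|h\|_{p(\cdot)}=\inf\{\mu>0:\int_{\mathbb R^n}(|h(x)|/\mu)^{p(x)}\,dx\le 1\}$, and $\|h\|_{L^{p(\cdot)}(E)}=\|h\chi_E\|_{p(\cdot)}$. All cubes are closed, of positive side length, with sides parallel to the coordinate axes, and $M$ is the Hardy–Littlewood maximal operator $Mh(x)=\sup_{Q\ni x}|Q|^{-1}\int_Q|h|$ over such cubes. We write $p(\cdot)\in M\mathcal P_0$ if in addition there is $p_0$ with $0<p_0<p_-=\operatorname{ess\,inf}p$ such that $\|Mh\|_{p(\cdot)/p_0}\le C\|h\|_{p(\cdot)/p_0}$ for all locally integrable $h$, with $C$ independent of $h$; fix such a $p_0$. For $\Phi\in\mathcal S(\mathbb R^n)$ and a tempered distribution $F$ let $\Phi_t(x)=t^{-n}\Phi(x/t)$, $M_{\Phi,0}F(x)=\sup_{t>0}|F*\Phi_t(x)|$ and $\mathcal M_NF(x)=\sup_{\Phi\in\mathcal S_N}M_{\Phi,0}F(x)$,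 where $\mathcal S_N$ is the set of $\Phi\in\mathcal S$ with $\sup_x|x^\alpha D^\beta\Phi(x)|\le 1$ for all multi-indices with $|\alpha|,|\beta|\le N$. Fix an integer $N>n/p_0+n+1$; $H^{p(\cdot)}$ is the set of tempered distributions $F$ with $\|\mathcal M_NF\|_{p(\cdot)}<\infty$. Theorem 5.1. Let $p(\cdot)\in M\mathcal P_0$, with $p_0$ and $N$ as above. There are constants $A$, depending only on $n$, $c$, depending only on $n,p(\cdot),p_0,N$, and $C_\Phi$ ($\Phi\in\mathcal S$), depending only on $n,p(\cdot),p_0,N,\Phi$, such that the following holds. Let $f\in L^1_{loc}\cap H^{p(\cdot)}$, that is, $f$ is a locally integrable complex-valued function that agrees, as a distribution on compactly supported smooth functions, with an element of $H^{p(\cdot)}$ (for which we also write $f$), and let $\lambda>0$. Then there are a countable (possibly empty) family of cubes $Q_k^*$ with $$\{x:\mathcal M_Nf(x)>\lambda\}=\bigcup_kQ_k^*,\qquad \sum_k\chi_{Q_k^*}(x)\le A\quad\text{for all }x,$$ and a measurable function $g$ and integrable functions $b_k$ such that $$f=g+\sum_kb_k,$$ where the sum converges absolutely almost everywhere and $\sum_k\int_K|b_k|\,dx<\infty$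 for every compact $K$; $|g|\le c\lambda$; and for every $k$: $\operatorname{supp}b_k\subset Q_k^*$; $\int b_k(x)x^\alpha\,dx=0$ for all multi-indices $\alpha$ with $|\alpha|\le\max\{0,\lfloor n(1/p_0-1)\rfloor\}$ (in particular $\int b_k\,dx=0$); and, for every $\Phi\in\mathcal S$, $$\|M_{\Phi,0}b_k\|_{L^{p(\cdot)}(\mathbb R^n)}\le C_\Phi\,\|\mathcal M_Nf\|_{L^{p(\cdot)}(Q_k^*)}.$$ -/

import Mathlib

open MeasureTheory Set
open scoped ENNReal NNReal SchwartzMap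

namespace VarHardy

/-- The space `ℝⁿ` with its Euclidean norm and Lebesgue measure. -/
abbrev Rn (n : ℕ) : Type := EuclideanSpace ℝ (Fin n)

/-- The closed cube with sides parallel to the axes, centre `c` and side length `ℓ`. -/
def cube {n : ℕ} (c : Rn n) (ℓ : ℝ) : Set (Rn n) := {x | ∀ i, |x i - c i| ≤ ℓ / 2}

/-- The modular `ρ(f) = ∫ f(x) ^ p(x) dx` of a function with values in `[0, ∞]`. -/
noncomputable def modular {n : ℕ} (p : Rn n → ℝ) (f : Rn n → ℝ≥0∞) : ℝ≥0∞ :=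
  ∫⁻ x, f x ^ p x

/-- The Luxemburg (quasi-)norm `inf {μ > 0 : ρ(f / μ) ≤ 1}` of a function with values in
`[0, ∞]`; it is `∞` if there is no such `μ`.  For `f` with complex values it is applied
to `|f|`. -/
noncomputable def varNorm {n : ℕ} (p : Rn n → ℝ) (f : Rn n → ℝ≥0∞) : ℝ≥0∞ :=
  ⨅ (μ : ℝ≥0) (_ : 0 < μ) (_ : modular p (fun x => f x / μ) ≤ 1), (μ : ℝ≥0∞)

/-- The Hardy-Littlewood maximal function over cubes containing the point, of a function with
values in `[0, ∞]`. -/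
noncomputable def hlMax {n : ℕ} (f : Rn n → ℝ≥0∞) (x : Rn n) : ℝ≥0∞ :=
  ⨆ (c : Rn n) (ℓ : ℝ) (_ : 0 < ℓ) (_ : x ∈ cube c ℓ),
    (volume (cube c ℓ))⁻¹ * ∫⁻ y in cube c ℓ, f y

/-- The exponent `p` is Lebesgue measurable with values in `(0, ∞)` and `p₊ < ∞`. -/
structure IsExponent {n : ℕ} (p : Rn n → ℝ) : Prop where
  aemeasurable : AEMeasurable p volume
  pos : ∀ x, 0 < p x
  essSup_lt_top : essSup (fun x => ENNReal.ofReal (p x)) volume < ∞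

/-- The class `MP₀`, with its parameter `p₀`: an exponent `p` with `p₊ < ∞` and
`0 < p₀ < p₋`, such that the Hardy-Littlewood maximal operator is bounded on the space with
exponent `p(·) / p₀`. -/
structure IsMP0 {n : ℕ} (p : Rn n → ℝ) (p₀ : ℝ) : Prop extends IsExponent p where
  p0_pos : 0 < p₀
  p0_lt : ENNReal.ofReal p₀ < essInf (fun x => ENNReal.ofReal (p x)) volume
  maximal_bounded : ∃ C : ℝ≥0, ∀ f : Rn n → ℝ, LocallyIntegrable f volume →
    varNorm (fun x => p x / p₀) (hlMax (fun x => ‖f x‖ₑ)) ≤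
      C * varNorm (fun x => p x / p₀) (fun x => ‖f x‖ₑ)

/-- The Schwartz function `y ↦ Φ_t(x - y) = t⁻ⁿ Φ((x - y) / t)`. -/
noncomputable def dilTrans {n : ℕ} (Φ : 𝓢(Rn n, ℂ)) (t : Ioi (0 : ℝ)) (x : Rn n) :
    𝓢(Rn n, ℂ) :=
  ((((t : ℝ) ^ n)⁻¹ : ℝ) : ℂ) •
    SchwartzMap.compSubConstCLM ℂ x
      (SchwartzMap.compCLMOfContinuousLinearEquiv ℂ
        (ContinuousLinearEquiv.smulLeft (R₁ := ℝ) (M₁ := Rn n)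
          (Units.mk0 (-(t : ℝ)⁻¹) (neg_ne_zero.mpr (inv_ne_zero (ne_of_gt t.2))))) Φ)

theorem dilTrans_apply {n : ℕ} (Φ : 𝓢(Rn n, ℂ)) (t : Ioi (0 : ℝ)) (x y : Rn n) :
    dilTrans Φ t x y = ((((t : ℝ) ^ n)⁻¹ : ℝ) : ℂ) * Φ ((t : ℝ)⁻¹ • (x - y)) := by
  have h : (-(t : ℝ)⁻¹) • (y - x) = (t : ℝ)⁻¹ • (x - y) := by
    rw [neg_smul, ← smul_neg, neg_sub]
  rw [← h]
  rfl

/-- The radial maximal function `M_{Φ,0} F(x) = sup_{t > 0} |F * Φ_t (x)|`, where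
`F * Φ_t (x) = ⟨F, Φ_t(x - ·)⟩`. -/
noncomputable def radialMax {n : ℕ} (Φ : 𝓢(Rn n, ℂ)) (F : 𝓢'(Rn n, ℂ)) (x : Rn n) : ℝ≥0∞ :=
  ⨆ t : Ioi (0 : ℝ), ‖F (dilTrans Φ t x)‖ₑ

/-- The set `S_N` of the Schwartz functions `φ` with `|x^α D^β φ(x)| ≤ 1` for all `x` and all
multi-indices `α`, `β` of order at most `N`.  A partial derivative of order `m` is given by the
sequence `I` of the `m` coordinates with respect to which one differentiates. -/
def unitS (n N : ℕ) : Set 𝓢(Rn n, ℂ) :=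
  {φ | ∀ α : Fin n → ℕ, ∑ i, α i ≤ N → ∀ m ≤ N, ∀ I : Fin m → Fin n, ∀ x : Rn n,
    |∏ i, x i ^ α i| *
      ‖iteratedFDeriv ℝ m φ x (fun j => EuclideanSpace.single (I j) (1 : ℝ))‖ ≤ 1}

/-- The grand maximal function `𝓜_N F(x) = sup_{Φ ∈ S_N} M_{Φ,0} F(x)`. -/
noncomputable def grandMax {n : ℕ} (N : ℕ) (F : 𝓢'(Rn n, ℂ)) (x : Rn n) : ℝ≥0∞ :=
  ⨆ Φ ∈ unitS n N, radialMax Φ F x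

/-- The tempered distribution `F` is in the variable Hardy space with exponent `p`, taken with
the grand maximal function of order `N`. -/
def MemHardy {n : ℕ} (p : Rn n → ℝ) (N : ℕ) (F : 𝓢'(Rn n, ℂ)) : Prop :=
  varNorm p (grandMax N F) < ∞

/-- The tempered distribution `F` is the locally integrable function `f`: the two agree on all
test functions. (The integral of `φ f` need not converge for other Schwartz functions `φ`.) -/
def IsLocIntegrableRep {n : ℕ} (F : 𝓢'(Rn n, ℂ)) (f : Rn n → ℂ) : Prop :=
  LocallyIntegrable f volume ∧
    ∀ φ : 𝓢(Rn n, ℂ), HasCompactSupport φ → F φ = ∫ x, φ x * f x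

/-- The tempered distribution `φ ↦ ∫ φ b` of an integrable function `b`. -/
noncomputable def distOf {n : ℕ} {b : Rn n → ℂ} (hb : Integrable b volume) : 𝓢'(Rn n, ℂ) :=
  Lp.toTemperedDistribution (hb.toL1 b)

theorem distOf_apply {n : ℕ} {b : Rn n → ℂ} (hb : Integrable b volume) (φ : 𝓢(Rn n, ℂ)) :
    distOf hb φ = ∫ x, φ x * b x := by
  rw [distOf, Lp.toTemperedDistribution_apply]
  refine integral_congr_ae ?_
  filter_upwards [hb.coeFn_toL1] with x hx
  rw [hx, smul_eq_mul]

end VarHardy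

namespace VarHardy

open scoped ContDiff

/-! This is a Calderón–Zygmund decomposition at height λ of the grand maximal function. The set Ω =
{𝓜_N f > λ} is open, being a superlevel set of a supremum of continuous functions. It has finite
measure because `p` is essentially bounded, so its complement is nonempty and `exists_whitney`
covers Ω by cubes whose sides are comparable to the distance to the complement. With a partition of
unity η_k (`exists_partition`) put b_k = η_k f − Q_k, where Q_k is bounded, lives on a small cube
and has the same moments as η_k f. Then g is f off Ω plus ∑ Q_k.

One estimate carries the rest: the integral of f against a bump of height one and scale ℓ is at most
C ℓⁿ 𝓜_N f(x), for every x within a fixed multiple of ℓ (`enorm_integral_mul_le`,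
`enorm_integral_cutoff_mul_le`). Tested at a point x₀ outside Ω near the cube, it bounds the moments
of η_k f and hence gives |Q_k| ≤ Cλ (`exists_moment_correction`). Off Ω, |f| ≤ C 𝓜_N f ≤ Cλ almost
everywhere (`exists_enorm_le_grandMax`). As F is an integral against f only on compactly supported
test functions, the cutoff η_k stays inside every such integral.

For the convolutions of b_k with Φ_t there are two regions. On the cube, η_k Φ_t(x − ·) is itself a
bump at x of scale min(t, ℓ), which gives C 𝓜_N f(x) (`exists_enorm_near_le`). Off the cube, the
vanishing moments allow the Taylor polynomial of degree d to be subtracted from Φ_t(x − ·), and the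
remainder, tested at x₀, gives Cλ(ℓ/|x − z|)^(n+d+1) (`exists_enorm_far_le`). Since n + d + 1 ≥
n/p₀, this tail is at most Cλ(Mχ)^(1/p₀) with χ the indicator of the cube. Boundedness of M with
exponent p/p₀ then bounds its norm by that of λχ, and λ < 𝓜_N f on the cube (`exists_varNorm_le`).
-/

theorem natCast_le_smooth (m : ℕ) : (m : WithTop ℕ∞) ≤ ((⊤ : ℕ∞) : WithTop ℕ∞) := by
  exact_mod_cast le_top

/-! ### Symmetry of higher derivatives, Taylor polynomials and their remainders -/

section Derivatives

variable {E : Type} [NormedAddCommGroup E] [NormedSpace ℝ E]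

/-- The iterated derivatives of a smooth function are symmetric. -/
theorem iteratedFDeriv_comp_perm_of_contDiff (m : ℕ) :
    ∀ {G : Type} [NormedAddCommGroup G] [NormedSpace ℝ G] {h : E → G}, ContDiff ℝ ∞ h →
      ∀ (x : E) (v : Fin m → E) (σ : Equiv.Perm (Fin m)),
        iteratedFDeriv ℝ m h x (v ∘ σ) = iteratedFDeriv ℝ m h x v := by
  induction m with
  | zero =>
    intro G _ _ h _ x v σ
    congr 1
    exact Subsingleton.elim _ _
  | succ m ih =>
    intro G _ _ h hh x v σ
    -- Adjacent transpositions generate the symmetric group. One that fixes the last slot is an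
    -- instance of the induction hypothesis for `fderiv ℝ h`, which is why the target space is
    -- quantified inside the induction. One that fixes the first slot reduces to `h` itself. Only
    -- for `m = 1` can neither happen, and this is the symmetry of the second derivative.
    have key : ∀ (i : Fin m) (v : Fin (m + 1) → E),
        iteratedFDeriv ℝ (m + 1) h x (v ∘ Equiv.swap i.castSucc i.succ) =
          iteratedFDeriv ℝ (m + 1) h x v := by
      intro i v
      by_cases hi : i.succ = Fin.last m
      · by_cases hi0 : i.castSucc = 0
        · have hm : m = 1 := by
            have h1 := congrArg Fin.val hi
            have h2 := congrArg Fin.val hi0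
            simp at h1 h2
            omega
          subst hm
          have hs : IsSymmSndFDerivAt ℝ h x :=
            ((hh.contDiffAt (x := x)).of_le (natCast_le_smooth 2)).isSymmSndFDerivAt (by simp)
          have hi' : i = 0 := Subsingleton.elim _ _
          subst hi'
          rw [iteratedFDeriv_two_apply, iteratedFDeriv_two_apply]
          simpa using hs.eq (v 1) (v 0)
        · have hd : DifferentiableAt ℝ (iteratedFDeriv ℝ m h) x :=
            (hh.differentiable_iteratedFDeriv (m := m) (by exact_mod_cast ENat.natCast_lt_top m)) x
          rw [hd.iteratedFDeriv_succ_apply_left', hd.iteratedFDeriv_succ_apply_left']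
          have h0 : (v ∘ Equiv.swap i.castSucc i.succ) 0 = v 0 := by
            simp only [Function.comp_apply]
            rw [Equiv.swap_apply_of_ne_of_ne (Ne.symm hi0) (Fin.succ_ne_zero i).symm]
          rw [h0]
          have hex : ∃ τ : Equiv.Perm (Fin m),
              Fin.tail (v ∘ Equiv.swap i.castSucc i.succ) = Fin.tail v ∘ τ := by
            obtain ⟨j, hj⟩ := Fin.exists_succ_eq.2 hi0
            refine ⟨Equiv.swap j i, ?_⟩
            rw [← hj]
            ext1 k
            simp only [Fin.tail, Function.comp_apply]
            congr 1
            exact ((Fin.succ_injective m).swap_apply j i k)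
          obtain ⟨τ, hτ⟩ := hex
          simp_rw [hτ, ih hh _ _ τ]
      · rw [iteratedFDeriv_succ_apply_right, iteratedFDeriv_succ_apply_right]
        have h0 : (v ∘ Equiv.swap i.castSucc i.succ) (Fin.last m) = v (Fin.last m) := by
          simp only [Function.comp_apply]
          rw [Equiv.swap_apply_of_ne_of_ne (Fin.castSucc_lt_last i).ne' (Ne.symm hi)]
        rw [h0]
        have hex : ∃ τ : Equiv.Perm (Fin m),
            Fin.init (v ∘ Equiv.swap i.castSucc i.succ) = Fin.init v ∘ τ := by
          obtain ⟨j, hj⟩ := Fin.exists_castSucc_eq.2 hi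
          refine ⟨Equiv.swap i j, ?_⟩
          rw [← hj]
          ext1 k
          simp only [Fin.init, Function.comp_apply]
          congr 1
          exact ((Fin.castSucc_injective m).swap_apply i j k)
        obtain ⟨τ, hτ⟩ := hex
        rw [hτ, ih (hh.fderiv_right (m := ∞) (by simp)) _ _ τ]
    have hσ : σ ∈ Submonoid.closure
        (Set.range fun i : Fin m => Equiv.swap i.castSucc i.succ) := by
      rw [Equiv.Perm.mclosure_swap_castSucc_succ]; trivial
    induction hσ using Submonoid.closure_induction generalizing v with
    | mem τ hτ => obtain ⟨i, rfl⟩ := hτ; exact key i v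
    | one => rfl
    | mul a b _ _ ha hb =>
      have : v ∘ (a * b : Equiv.Perm _) = (v ∘ a) ∘ b := rfl
      rw [this, hb, ha]

/-- A continuous multilinear map is smooth on the diagonal. -/
theorem contDiff_diagonal {G : Type} [NormedAddCommGroup G] [NormedSpace ℝ G] {m : ℕ}
    (A : E [×m]→L[ℝ] G) (c : E) : ContDiff ℝ ∞ (fun y => A (fun _ => y - c)) :=
  A.contDiff.comp (contDiff_pi.2 fun _ => contDiff_id.sub contDiff_const)

/-- Only the vanishing of the right-hand side matters: the falling factorial is zero for `k > m`,
and the power of the norm is zero at the centre for `k < m`. So `K` may be left unspecified. -/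
theorem norm_iteratedFDeriv_diagonal_le {G : Type} [NormedAddCommGroup G] [NormedSpace ℝ G]
    {m : ℕ} (A : E [×m]→L[ℝ] G) (c y : E) (k : ℕ) :
    ∃ K : ℝ, ‖iteratedFDeriv ℝ k (fun y => A (fun _ => y - c)) y‖ ≤
      (m.descFactorial k : ℝ) * ‖A‖ * ‖fun _ : Fin m => y - c‖ ^ (m - k) * K := by
  let L : E →L[ℝ] (Fin m → E) := ContinuousLinearMap.pi (fun _ => ContinuousLinearMap.id ℝ E)
  refine ⟨∏ _i : Fin k, ‖L‖, ?_⟩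
  have h1 : iteratedFDeriv ℝ k (fun y => A (fun _ => y - c)) y =
      iteratedFDeriv ℝ k (A ∘ L) (y - c) :=
    iteratedFDeriv_comp_sub (f := A ∘ L) k c y
  rw [h1, ContinuousLinearMap.iteratedFDeriv_comp_right (n := ∞) L A.contDiff _
    (by exact_mod_cast le_top)]
  refine (ContinuousMultilinearMap.norm_compContinuousLinearMap_le _ _).trans ?_
  gcongr
  have h2 := ContinuousMultilinearMap.norm_iteratedFDeriv_le A k (L (y - c))
  rw [Fintype.card_fin] at h2
  exact h2

theorem iteratedFDeriv_diagonal_eq_zero_of_lt {G : Type} [NormedAddCommGroup G]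
    [NormedSpace ℝ G] {m : ℕ} (A : E [×m]→L[ℝ] G) (c y : E) {k : ℕ} (hk : m < k) :
    iteratedFDeriv ℝ k (fun y => A (fun _ => y - c)) y = 0 := by
  obtain ⟨K, hK⟩ := norm_iteratedFDeriv_diagonal_le A c y k
  rw [Nat.descFactorial_of_lt hk] at hK
  simpa using hK

theorem iteratedFDeriv_diagonal_center_of_lt {G : Type} [NormedAddCommGroup G]
    [NormedSpace ℝ G] {m : ℕ} (A : E [×m]→L[ℝ] G) (c : E) {k : ℕ} (hk : k < m) :
    iteratedFDeriv ℝ k (fun y => A (fun _ => y - c)) c = 0 := by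
  obtain ⟨K, hK⟩ := norm_iteratedFDeriv_diagonal_le A c c k
  have : ‖fun _ : Fin m => c - c‖ = 0 := by
    rw [norm_eq_zero]; ext; simp
  rw [this, zero_pow (by omega)] at hK
  simpa using hK

/-- The Taylor polynomial of degree `d` at `c` of a smooth function, up to its description as a
sum of multilinear maps on the diagonal. -/
theorem exists_taylor {h : E → ℂ} (hh : ContDiff ℝ ∞ h) (c : E) (d : ℕ) :
    ∃ A : ∀ m : ℕ, E [×m]→L[ℝ] ℂ,
      (∀ m ≤ d, iteratedFDeriv ℝ m
        (fun y => h y - ∑ k ∈ Finset.range (d + 1), A k (fun _ => y - c)) c = 0) ∧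
      ∀ m, d < m → ∀ y, iteratedFDeriv ℝ m
        (fun y => h y - ∑ k ∈ Finset.range (d + 1), A k (fun _ => y - c)) y =
          iteratedFDeriv ℝ m h y := by
  have step : ∀ (m : ℕ) (R : E → ℂ), ContDiff ℝ ∞ R →
      ∃ B : E [×m]→L[ℝ] ℂ, iteratedFDeriv ℝ m (fun y => R y - B (fun _ => y - c)) c = 0 := by
    intro m R hR
    -- The `m`-th derivative of a diagonal sums the form over all permutations of its arguments. By
    -- symmetry of the derivative the `m!` terms agree, which explains the normalisation.
    let B := (m.factorial : ℝ)⁻¹ • iteratedFDeriv ℝ m R c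
    refine ⟨B, ?_⟩
    have h1 := fun_iteratedFDeriv_sub_apply (𝕜 := ℝ) (i := m) (x := c)
      (hR.contDiffAt.of_le (by exact_mod_cast le_top))
      ((contDiff_diagonal B c).contDiffAt.of_le (by exact_mod_cast le_top))
    rw [h1, sub_eq_zero]
    ext v
    have h2 : iteratedFDeriv ℝ m (fun y => B (fun _ => y - c)) c =
        iteratedFDeriv ℝ m (fun y => B (fun _ => y)) (c - c) :=
      iteratedFDeriv_comp_sub (f := fun y => B (fun _ => y)) m c c
    rw [h2, ContinuousMultilinearMap.iteratedFDeriv_comp_diagonal]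
    have h3 : ∀ σ : Equiv.Perm (Fin m), B (fun i => v (σ i)) =
        (m.factorial : ℝ)⁻¹ • iteratedFDeriv ℝ m R c v := by
      intro σ
      have := iteratedFDeriv_comp_perm_of_contDiff m hR c v σ
      simp only [B, _root_.smul_apply]
      rw [← this]; rfl
    simp only [h3, Finset.sum_const, Finset.card_univ, Fintype.card_perm, Fintype.card_fin]
    rw [← Nat.cast_smul_eq_nsmul ℝ, smul_smul, mul_inv_cancel₀, one_smul]
    exact_mod_cast m.factorial_ne_zero
  induction d with
  | zero =>
    obtain ⟨B, hB⟩ := step 0 h hh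
    refine ⟨fun m => if hm : m = 0 then hm ▸ B else 0, ?_, ?_⟩
    · intro m hm
      obtain rfl : m = 0 := by omega
      simpa using hB
    · intro m hm y
      simp only [zero_add, Finset.range_one, Finset.sum_singleton]
      rw [fun_iteratedFDeriv_sub_apply (𝕜 := ℝ) (i := m)
        (hh.contDiffAt.of_le (by exact_mod_cast le_top))
        ((contDiff_diagonal _ c).contDiffAt.of_le (by exact_mod_cast le_top)),
        iteratedFDeriv_diagonal_eq_zero_of_lt _ c y hm, sub_zero]
  | succ d ih =>
    obtain ⟨A, hA1, hA2⟩ := ih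
    set R : E → ℂ := fun y => h y - ∑ k ∈ Finset.range (d + 1), A k (fun _ => y - c) with hRdef
    have hR : ContDiff ℝ ∞ R :=
      hh.sub (ContDiff.sum fun k _ => contDiff_diagonal (A k) c)
    obtain ⟨B, hB⟩ := step (d + 1) R hR
    -- The new term of degree `d + 1` disturbs neither range of orders: its lower derivatives vanish
    -- at `c` and its higher ones vanish everywhere.
    let A' : ∀ m : ℕ, E [×m]→L[ℝ] ℂ := Function.update A (d + 1) B
    have hA' : (fun y => h y - ∑ k ∈ Finset.range (d + 1 + 1), A' k (fun _ => y - c)) =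
        fun y => R y - B (fun _ => y - c) := by
      ext y
      rw [Finset.sum_range_succ]
      have e1 : A' (d + 1) = B := Function.update_self _ _ _
      have e2 : ∑ k ∈ Finset.range (d + 1), A' k (fun _ => y - c) =
          ∑ k ∈ Finset.range (d + 1), A k (fun _ => y - c) := by
        refine Finset.sum_congr rfl fun k hk => ?_
        have : A' k = A k := Function.update_of_ne (by
          have := Finset.mem_range.1 hk; omega) _ _
        rw [this]
      rw [e1, e2, hRdef]
      ring
    have hsub : ∀ (m : ℕ) (y : E), iteratedFDeriv ℝ m (fun y => R y - B (fun _ => y - c)) y =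
        iteratedFDeriv ℝ m R y - iteratedFDeriv ℝ m (fun y => B (fun _ => y - c)) y :=
      fun m y => fun_iteratedFDeriv_sub_apply (𝕜 := ℝ) (i := m)
        (hR.contDiffAt.of_le (by exact_mod_cast le_top))
        ((contDiff_diagonal _ c).contDiffAt.of_le (by exact_mod_cast le_top))
    refine ⟨A', ?_, ?_⟩
    · intro m hm
      rw [hA']
      rcases Nat.lt_or_ge d m with h1 | h1
      · obtain rfl : m = d + 1 := by omega
        exact hB
      · rw [hsub, hA1 m h1, iteratedFDeriv_diagonal_center_of_lt B c (by omega), sub_zero]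
    · intro m hm y
      rw [hA', hsub, hA2 m (by omega), iteratedFDeriv_diagonal_eq_zero_of_lt B c y hm, sub_zero]

/-- If the derivatives of order at most `d` vanish at `c` and those of order between `d + 1`
and `N` have the bounds `B r ^ (-m)` on the ball, so do all those of order at most `N`. -/
theorem norm_iteratedFDeriv_le_of_vanish {R : E → ℂ} (hR : ContDiff ℝ ∞ R) {c : E} {r B : ℝ}
    (hr : 0 < r) {d N : ℕ} (hdN : d < N) (h0 : ∀ m ≤ d, iteratedFDeriv ℝ m R c = 0)
    (h1 : ∀ m, d < m → m ≤ N → ∀ y ∈ Metric.closedBall c r,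
      ‖iteratedFDeriv ℝ m R y‖ ≤ B * r⁻¹ ^ m) :
    ∀ m ≤ N, ∀ y ∈ Metric.closedBall c r, ‖iteratedFDeriv ℝ m R y‖ ≤ B * r⁻¹ ^ m := by
  -- Downward induction on the order: the mean value inequality from the centre, where the
  -- derivative is zero, trades one order for one factor `r`, with the same `B`.
  have key : ∀ j ≤ d + 1, ∀ m, d + 1 - j ≤ m → m ≤ N → ∀ y ∈ Metric.closedBall c r,
      ‖iteratedFDeriv ℝ m R y‖ ≤ B * r⁻¹ ^ m := by
    intro j
    induction j with
    | zero => intro _ m hm; exact h1 m (by omega)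
    | succ j ih =>
      intro hj m hm hmN y hy
      rcases Nat.lt_or_ge d m with h2 | h2
      · exact h1 m h2 hmN y hy
      · have hd : Differentiable ℝ (iteratedFDeriv ℝ m R) :=
          hR.differentiable_iteratedFDeriv (m := m) (by exact_mod_cast ENat.natCast_lt_top m)
        have hmv := (convex_closedBall c r).norm_image_sub_le_of_norm_fderiv_le (𝕜 := ℝ)
          (f := iteratedFDeriv ℝ m R) (C := B * r⁻¹ ^ (m + 1)) (fun z _ => hd z)
          (fun z hz => by
            rw [norm_fderiv_iteratedFDeriv]
            exact ih (by omega) (m + 1) (by omega) (by omega) z hz)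
          (Metric.mem_closedBall_self hr.le) hy
        rw [h0 m h2, sub_zero] at hmv
        have hB : 0 ≤ B * r⁻¹ ^ (m + 1) :=
          (norm_nonneg _).trans (ih (by omega) (m + 1) (by omega) (by omega) y hy)
        calc _ ≤ B * r⁻¹ ^ (m + 1) * ‖y - c‖ := hmv
          _ ≤ B * r⁻¹ ^ (m + 1) * r := by
            gcongr; rwa [← dist_eq_norm]
          _ = B * r⁻¹ ^ m := by rw [pow_succ]; field_simp
  intro m hm
  exact key (d + 1) le_rfl m (by omega) hm

end Derivatives

/-! ### Calculus of derivative bounds at a given scale -/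

section ScaleBounds

variable {E : Type} [NormedAddCommGroup E] [NormedSpace ℝ E]

/-- The derivatives at `y` of order at most `N` have the size `B` at scale `ℓ`. -/
def ScaleBound (N : ℕ) (ℓ B : ℝ) (η : E → ℂ) (y : E) : Prop :=
  ∀ m ≤ N, ‖iteratedFDeriv ℝ m η y‖ ≤ B * ℓ⁻¹ ^ m

theorem ScaleBound.nonneg {N : ℕ} {ℓ B : ℝ} {η : E → ℂ} {y : E} (h : ScaleBound N ℓ B η y) :
    0 ≤ B := by
  simpa using (norm_nonneg _).trans (h 0 (Nat.zero_le _))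

theorem ScaleBound.norm_le {N : ℕ} {ℓ B : ℝ} {η : E → ℂ} {y : E} (h : ScaleBound N ℓ B η y) :
    ‖η y‖ ≤ B := by
  simpa using h 0 (Nat.zero_le _)

theorem ScaleBound.mono {N : ℕ} {ℓ ℓ' B B' : ℝ} {η : E → ℂ} {y : E}
    (h : ScaleBound N ℓ B η y) (hℓ' : 0 < ℓ') (hℓ : ℓ' ≤ ℓ) (hB : B ≤ B') :
    ScaleBound N ℓ' B' η y := by
  intro m hm
  have h0 : 0 ≤ B := h.nonneg
  have h1 : ℓ⁻¹ ≤ ℓ'⁻¹ := inv_anti₀ hℓ' hℓ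
  have h2 : 0 ≤ ℓ⁻¹ := inv_nonneg.2 (hℓ'.le.trans hℓ)
  exact (h m hm).trans (mul_le_mul hB (pow_le_pow_left₀ h2 h1 m) (pow_nonneg h2 m)
    (h0.trans hB))

theorem ScaleBound.mul {N : ℕ} {ℓ B B' : ℝ} {η ζ : E → ℂ} {y : E} (hℓ : 0 < ℓ)
    (hη : ContDiff ℝ ∞ η) (hζ : ContDiff ℝ ∞ ζ)
    (h : ScaleBound N ℓ B η y) (h' : ScaleBound N ℓ B' ζ y) :
    ScaleBound N ℓ (2 ^ N * B * B') (fun y => η y * ζ y) y := by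
  intro m hm
  have hB := h.nonneg
  have hB' := h'.nonneg
  refine (norm_iteratedFDeriv_mul_le hη hζ y (n := m) (by exact_mod_cast le_top)).trans ?_
  have h1 : ∀ i ∈ Finset.range (m + 1),
      (m.choose i : ℝ) * ‖iteratedFDeriv ℝ i η y‖ * ‖iteratedFDeriv ℝ (m - i) ζ y‖ ≤
        (m.choose i : ℝ) * (B * B' * ℓ⁻¹ ^ m) := by
    intro i hi
    have him : i ≤ m := Nat.lt_succ_iff.1 (Finset.mem_range.1 hi)
    have e : B * B' * ℓ⁻¹ ^ m = (B * ℓ⁻¹ ^ i) * (B' * ℓ⁻¹ ^ (m - i)) := by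
      rw [← Nat.add_sub_cancel' him, pow_add]; simp; ring
    rw [mul_assoc, e]
    gcongr
    · exact h i (him.trans hm)
    · exact h' (m - i) ((Nat.sub_le _ _).trans hm)
  refine (Finset.sum_le_sum h1).trans ?_
  rw [← Finset.sum_mul]
  have h2 : ∑ i ∈ Finset.range (m + 1), (m.choose i : ℝ) = 2 ^ m := by
    exact_mod_cast Nat.sum_range_choose m
  rw [h2]
  have h3 : (2 : ℝ) ^ m ≤ 2 ^ N := pow_le_pow_right₀ (by norm_num) hm
  calc _ ≤ 2 ^ N * (B * B' * ℓ⁻¹ ^ m) := by gcongr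
    _ = _ := by ring

theorem ScaleBound.prod {ι : Type} {N A : ℕ} {ℓ B : ℝ} (hB : 1 ≤ B) {η : ι → E → ℂ} {y : E}
    (hℓ : 0 < ℓ) (s : Finset ι) (hη : ∀ i ∈ s, ContDiff ℝ ∞ (η i))
    (h : ∀ i ∈ s, ScaleBound N ℓ B (η i) y) (hs : s.card ≤ A) :
    ScaleBound N ℓ ((2 ^ N * B) ^ A) (fun y => ∏ i ∈ s, η i y) y := by
  classical
  have hB2 : 1 ≤ 2 ^ N * B := one_le_mul_of_one_le_of_one_le (one_le_pow₀ (by norm_num)) hB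
  have main : ScaleBound N ℓ ((2 ^ N * B) ^ s.card) (fun y => ∏ i ∈ s, η i y) y := by
    clear hs
    induction s using Finset.induction_on with
    | empty =>
      intro m _
      rcases Nat.eq_zero_or_pos m with rfl | h0
      · simp
      · simp only [Finset.prod_empty]
        rw [iteratedFDeriv_const_of_ne (by omega)]
        simp; positivity
    | insert a s ha ih =>
      have h1 := ih (fun i hi => hη i (Finset.mem_insert_of_mem hi))
        (fun i hi => h i (Finset.mem_insert_of_mem hi))
      have h2 := ScaleBound.mul hℓ (hη a (Finset.mem_insert_self _ _))
        (contDiff_prod fun i hi => hη i (Finset.mem_insert_of_mem hi))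
        (h a (Finset.mem_insert_self _ _)) h1
      simp only [Finset.prod_insert ha, Finset.card_insert_of_notMem ha]
      rw [pow_succ']
      exact h2
  exact main.mono hℓ le_rfl (pow_le_pow_right₀ hB2 hs)

theorem ScaleBound.congr {N : ℕ} {ℓ B : ℝ} {η ζ : E → ℂ} {y : E}
    (h : ScaleBound N ℓ B η y) (he : ζ =ᶠ[nhds y] η) : ScaleBound N ℓ B ζ y := by
  intro m hm
  rw [(he.iteratedFDeriv ℝ m).eq_of_nhds]
  exact h m hm

theorem ScaleBound.of_notMem_tsupport {N : ℕ} {ℓ B : ℝ} {η : E → ℂ} {y : E}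
    (hℓ : 0 < ℓ) (hB : 0 ≤ B) (hy : y ∉ tsupport η) : ScaleBound N ℓ B η y := by
  intro m hm
  have : iteratedFDeriv ℝ m η y = 0 := by
    by_contra h
    exact hy (support_iteratedFDeriv_subset m h)
  rw [this]; simp; positivity

theorem norm_iteratedFDeriv_comp_affine {G : Type} [NormedAddCommGroup G] [NormedSpace ℝ G]
    {h : E → G} (hh : ContDiff ℝ ∞ h) (a : E) (s : ℝ) (m : ℕ) (y : E) :
    ‖iteratedFDeriv ℝ m (fun y => h (a + s • y)) y‖ =
      |s| ^ m * ‖iteratedFDeriv ℝ m h (a + s • y)‖ := by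
  have h1 : ContDiff ℝ m (fun z => h (a + z)) :=
    (hh.comp (contDiff_const.add contDiff_id)).of_le (by exact_mod_cast le_top)
  have h2 := congrFun (iteratedFDeriv_comp_const_smul (i := m) s h1) y
  rw [h2, iteratedFDeriv_comp_add_left, norm_smul, norm_pow, Real.norm_eq_abs]

/-- Derivatives of the dilated and translated function `y ↦ h ((x - y) / t)`. -/
theorem norm_iteratedFDeriv_dil {h : E → ℂ} (hh : ContDiff ℝ ∞ h) (x : E) {t : ℝ} (ht : 0 < t)
    (m : ℕ) (y : E) :
    ‖iteratedFDeriv ℝ m (fun y => h (t⁻¹ • (x - y))) y‖ =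
      t⁻¹ ^ m * ‖iteratedFDeriv ℝ m h (t⁻¹ • (x - y))‖ := by
  have e : ∀ y, t⁻¹ • (x - y) = t⁻¹ • x + (-t⁻¹) • y := by intro y; rw [smul_sub, neg_smul]; abel
  simp only [e]
  rw [norm_iteratedFDeriv_comp_affine hh, abs_neg, abs_of_pos (inv_pos.2 ht)]

end ScaleBounds

/-! ### Testing against the grand maximal function -/

section GrandMax

variable {n : ℕ}

/-- The isotropic weight dominates every monomial of order at most `N`, and the operator norm
dominates every partial derivative. Only this inclusion is needed, so coordinates can be forgotten
from here on. -/
theorem mem_unitS_of_bound {N : ℕ} {φ : 𝓢(Rn n, ℂ)}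
    (h : ∀ m ≤ N, ∀ x, (1 + ‖x‖) ^ N * ‖iteratedFDeriv ℝ m φ x‖ ≤ 1) : φ ∈ unitS n N := by
  intro α hα m hm I x
  have h1 : |∏ i, x i ^ α i| ≤ (1 + ‖x‖) ^ N := by
    rw [Finset.abs_prod]
    calc ∏ i, |x i ^ α i| ≤ ∏ i, (1 + ‖x‖) ^ α i := by
          refine Finset.prod_le_prod (fun _ _ => abs_nonneg _) fun i _ => ?_
          rw [abs_pow]
          have : |x i| ≤ ‖x‖ := PiLp.norm_apply_le x i
          gcongr; linarith
      _ = (1 + ‖x‖) ^ (∑ i, α i) := by rw [Finset.prod_pow_eq_pow_sum]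
      _ ≤ _ := pow_le_pow_right₀ (by linarith [norm_nonneg x]) hα
  have h2 : ‖iteratedFDeriv ℝ m φ x (fun j => EuclideanSpace.single (I j) (1 : ℝ))‖ ≤
      ‖iteratedFDeriv ℝ m φ x‖ := by
    refine (ContinuousMultilinearMap.le_opNorm _ _).trans ?_
    simp
  exact (mul_le_mul h1 h2 (norm_nonneg _) (by positivity)).trans (h m hm x)

/-- By linearity of the pairing: division by `B` normalises `φ` into the test class, at the cost of
the factor `B`. -/
theorem enorm_apply_dilTrans_le {N : ℕ} (F : 𝓢'(Rn n, ℂ)) {φ : 𝓢(Rn n, ℂ)} {B : ℝ} (hB : 0 < B)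
    (h : ∀ m ≤ N, ∀ x, (1 + ‖x‖) ^ N * ‖iteratedFDeriv ℝ m φ x‖ ≤ B) (t : Ioi (0 : ℝ))
    (x : Rn n) : ‖F (dilTrans φ t x)‖ₑ ≤ ENNReal.ofReal B * grandMax N F x := by
  let ψ : 𝓢(Rn n, ℂ) := ((B⁻¹ : ℝ) : ℂ) • φ
  have hψ : ψ ∈ unitS n N := by
    refine mem_unitS_of_bound fun m hm y => ?_
    have h1 : iteratedFDeriv ℝ m ψ y = ((B⁻¹ : ℝ) : ℂ) • iteratedFDeriv ℝ m φ y :=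
      iteratedFDeriv_const_smul_apply
        (((φ.smooth ⊤).contDiffAt).of_le (by exact_mod_cast le_top))
    rw [h1, norm_smul, Complex.norm_real, Real.norm_of_nonneg (inv_nonneg.2 hB.le)]
    have := h m hm y
    rw [mul_left_comm, inv_mul_le_iff₀ hB, mul_one]
    exact this
  have h2 : dilTrans φ t x = (B : ℂ) • dilTrans ψ t x := by
    ext y
    simp only [_root_.smul_apply, dilTrans_apply, ψ, smul_eq_mul]
    push_cast
    have : (B : ℂ) ≠ 0 := by exact_mod_cast hB.ne'
    field_simp
  rw [h2, map_smul, smul_eq_mul, enorm_mul]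
  refine mul_le_mul' ?_ ?_
  · rw [← ofReal_norm, Complex.norm_real, Real.norm_of_nonneg hB.le]
  · exact (le_iSup (fun t => ‖F (dilTrans ψ t x)‖ₑ) t).trans
      (le_iSup₂ (f := fun Φ (_ : Φ ∈ unitS n N) => radialMax Φ F x) ψ hψ)

/-- Integrals against a bump function of scale `ℓ` near `x` are controlled by the grand maximal
function at `x`. -/
theorem enorm_integral_mul_le {N : ℕ} {F : 𝓢'(Rn n, ℂ)} {f : Rn n → ℂ}
    (hF : IsLocIntegrableRep F f) {η : Rn n → ℂ} (hη : ContDiff ℝ ∞ η)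
    (hc : HasCompactSupport η) {x : Rn n} {ℓ B : ℝ} (hℓ : 0 < ℓ) (hB : 0 < B)
    (h : ∀ m ≤ N, ∀ y, (1 + ‖y - x‖ / ℓ) ^ N * ‖iteratedFDeriv ℝ m η y‖ ≤ B * ℓ⁻¹ ^ m) :
    ‖∫ y, η y * f y‖ₑ ≤ ENNReal.ofReal (B * ℓ ^ n) * grandMax N F x := by
  -- Chosen so that η is exactly the dilate of ψ by ℓ, reflected and moved to x: η(y) = ℓ⁻ⁿ ψ((x −
  -- y)/ℓ).
  let ψf : Rn n → ℂ := fun u => ((ℓ ^ n : ℝ) : ℂ) * η (x + (-ℓ) • u)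
  have hcomp : ContDiff ℝ ∞ (fun u : Rn n => η (x + (-ℓ) • u)) :=
    hη.comp (by fun_prop : ContDiff ℝ ∞ fun u : Rn n => x + (-ℓ) • u)
  have hψs : ContDiff ℝ ∞ ψf := contDiff_const.mul hcomp
  have hψc : HasCompactSupport ψf := by
    refine HasCompactSupport.mul_left ?_
    let e : Rn n ≃ₜ Rn n := (Homeomorph.smulOfNeZero (-ℓ) (neg_ne_zero.2 hℓ.ne')).trans
      (Homeomorph.addLeft x)
    exact hc.comp_homeomorph e
  let ψ : 𝓢(Rn n, ℂ) := hψc.toSchwartzMap hψs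
  have hψb : ∀ m ≤ N, ∀ u, (1 + ‖u‖) ^ N * ‖iteratedFDeriv ℝ m ψ u‖ ≤ B * ℓ ^ n := by
    intro m hm u
    have h1 : iteratedFDeriv ℝ m ψ u =
        ((ℓ ^ n : ℝ) : ℂ) • iteratedFDeriv ℝ m (fun u : Rn n => η (x + (-ℓ) • u)) u :=
      iteratedFDeriv_const_smul_apply (a := ((ℓ ^ n : ℝ) : ℂ))
        (hcomp.contDiffAt.of_le (by exact_mod_cast le_top))
    rw [h1, norm_smul, Complex.norm_real, Real.norm_of_nonneg (by positivity),
      norm_iteratedFDeriv_comp_affine hη, abs_neg, abs_of_pos hℓ]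
    have h2 := h m hm (x + (-ℓ) • u)
    have h3 : ‖x + (-ℓ) • u - x‖ / ℓ = ‖u‖ := by
      rw [add_sub_cancel_left, norm_smul, norm_neg, Real.norm_of_nonneg hℓ.le]
      field_simp
    rw [h3] at h2
    calc _ = ℓ ^ n * ℓ ^ m * ((1 + ‖u‖) ^ N * ‖iteratedFDeriv ℝ m η (x + -ℓ • u)‖) := by ring
      _ ≤ ℓ ^ n * ℓ ^ m * (B * ℓ⁻¹ ^ m) := by gcongr
      _ = B * ℓ ^ n := by rw [inv_pow]; field_simp
  have h4 : ∀ y, dilTrans ψ ⟨ℓ, hℓ⟩ x y = η y := by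
    intro y
    rw [dilTrans_apply]
    change _ * (((ℓ ^ n : ℝ) : ℂ) * η (x + (-ℓ) • ((ℓ : ℝ)⁻¹ • (x - y)))) = η y
    rw [smul_smul, neg_mul, mul_inv_cancel₀ hℓ.ne', neg_smul, one_smul, neg_sub,
      add_sub_cancel, ← mul_assoc, ← Complex.ofReal_mul, inv_mul_cancel₀ (pow_pos hℓ n).ne']
    simp
  have h5 : (dilTrans ψ ⟨ℓ, hℓ⟩ x : Rn n → ℂ) = η := funext h4
  have h6 := hF.2 (dilTrans ψ ⟨ℓ, hℓ⟩ x) (by rw [h5]; exact hc)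
  rw [h5] at h6
  rw [← h6]
  exact enorm_apply_dilTrans_le F (by positivity) hψb _ x

end GrandMax

/-! ### Semicontinuity of the grand maximal function and pointwise domination -/

section Schwartz

variable {n : ℕ}

theorem exists_schwartz_bound (φ : 𝓢(Rn n, ℂ)) (k M : ℕ) :
    ∃ S : ℝ, 0 < S ∧ ∀ m ≤ M, ∀ x, (1 + ‖x‖) ^ k * ‖iteratedFDeriv ℝ m φ x‖ ≤ S :=
  ⟨2 ^ k * (Finset.Iic (k, M)).sup (fun m => SchwartzMap.seminorm ℝ m.1 m.2) φ + 1,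
    by positivity, fun m hm x => (SchwartzMap.one_add_le_sup_seminorm_apply (𝕜 := ℝ)
      (m := (k, M)) le_rfl hm φ x).trans (by linarith)⟩

/-- Translation is continuous in the Schwartz space. -/
theorem continuous_compSubConstCLM (Ψ : 𝓢(Rn n, ℂ)) :
    Continuous (fun x : Rn n => SchwartzMap.compSubConstCLM ℂ x Ψ) := by
  rw [continuous_iff_continuousAt]
  intro x₀
  refine ((schwartz_withSeminorms ℂ (Rn n) ℂ).tendsto_nhds _ _).2 ?_
  rintro ⟨k, m⟩ ε hε
  obtain ⟨S, hS0, hS⟩ := exists_schwartz_bound Ψ k (m + 1)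
  set D : ℝ := (2 + ‖x₀‖) ^ k * S with hD
  have hD0 : 0 < D := by positivity
  have hev : ∀ᶠ x in nhds x₀, ‖x - x₀‖ < min 1 (ε / (2 * D)) := by
    have := Metric.ball_mem_nhds x₀ (show 0 < min 1 (ε / (2 * D)) by positivity)
    filter_upwards [this] with x hx
    rwa [← dist_eq_norm]
  filter_upwards [hev] with x hx
  have hx1 : ‖x - x₀‖ < 1 := hx.trans_le (min_le_left _ _)
  have hx2 : ‖x - x₀‖ < ε / (2 * D) := hx.trans_le (min_le_right _ _)
  refine lt_of_le_of_lt (b := D * ‖x - x₀‖) ?_ ?_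
  · refine SchwartzMap.seminorm_le_bound ℂ k m _ (by positivity) fun y => ?_
    have h1 : iteratedFDeriv ℝ m
        (SchwartzMap.compSubConstCLM ℂ x Ψ - SchwartzMap.compSubConstCLM ℂ x₀ Ψ : 𝓢(Rn n, ℂ)) y =
        iteratedFDeriv ℝ m Ψ (y - x) - iteratedFDeriv ℝ m Ψ (y - x₀) := by
      have hsm : ∀ a : Rn n, ContDiff ℝ m (fun y => Ψ (y - a)) := fun a =>
        ((Ψ.smooth ⊤).comp (contDiff_id.sub contDiff_const)).of_le (natCast_le_smooth m)
      have e := fun_iteratedFDeriv_sub_apply (𝕜 := ℝ) (i := m) (x := y)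
        (hsm x).contDiffAt (hsm x₀).contDiffAt
      rw [iteratedFDeriv_comp_sub, iteratedFDeriv_comp_sub] at e
      exact e
    rw [h1]
    have hd : Differentiable ℝ (iteratedFDeriv ℝ m Ψ) :=
      (Ψ.smooth ⊤).differentiable_iteratedFDeriv (m := m)
        (by exact_mod_cast ENat.natCast_lt_top m)
    -- Mean value inequality with the weight ‖y‖^k frozen: along the unit ball around y − x₀ it is
    -- at most ((2 + ‖x₀‖)(1 + ‖z‖))^k, which the decay of the derivative of order m + 1 absorbs.
    have hmv := (convex_closedBall (y - x₀) 1).norm_image_sub_le_of_norm_fderiv_le (𝕜 := ℝ)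
      (f := fun z => ‖y‖ ^ k • iteratedFDeriv ℝ m Ψ z) (C := D) (x := y - x₀) (y := y - x)
      (fun z _ => (hd z).fun_const_smul _)
      (fun z hz => by
        rw [fderiv_fun_const_smul (hd z), norm_smul, norm_fderiv_iteratedFDeriv,
          Real.norm_of_nonneg (by positivity)]
        have hz' : ‖z - (y - x₀)‖ ≤ 1 := by rwa [← dist_eq_norm]
        have hy : ‖y‖ ≤ (2 + ‖x₀‖) * (1 + ‖z‖) := by
          have e : y = z - (z - (y - x₀)) + x₀ := by abel
          have := norm_add_le (z - (z - (y - x₀))) x₀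
          rw [← e] at this
          have h3 := norm_sub_le z (z - (y - x₀))
          nlinarith [norm_nonneg z, norm_nonneg x₀]
        calc _ ≤ ((2 + ‖x₀‖) * (1 + ‖z‖)) ^ k * ‖iteratedFDeriv ℝ (m + 1) Ψ z‖ := by gcongr
          _ = (2 + ‖x₀‖) ^ k * ((1 + ‖z‖) ^ k * ‖iteratedFDeriv ℝ (m + 1) Ψ z‖) := by
            rw [mul_pow]; ring
          _ ≤ D := by rw [hD]; gcongr; exact hS _ le_rfl z)
      (Metric.mem_closedBall_self zero_le_one)
      (by
        rw [Metric.mem_closedBall, dist_eq_norm, sub_sub_sub_cancel_left, ← norm_neg, neg_sub]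
        exact hx1.le)
    rw [← smul_sub, norm_smul, Real.norm_of_nonneg (by positivity), sub_sub_sub_cancel_left,
      ← norm_neg (x₀ - x), neg_sub] at hmv
    exact hmv
  · calc D * ‖x - x₀‖ ≤ D * (ε / (2 * D)) := by gcongr
      _ = ε / 2 := by field_simp
      _ < ε := by linarith

theorem continuous_apply_dilTrans (F : 𝓢'(Rn n, ℂ)) (Φ : 𝓢(Rn n, ℂ)) (t : Ioi (0 : ℝ)) :
    Continuous (fun x => F (dilTrans Φ t x)) := by
  have h : Continuous (fun x => dilTrans Φ t x) := by
    unfold dilTrans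
    exact Continuous.fun_const_smul (continuous_compSubConstCLM _) _
  exact F.continuous.comp h

theorem isOpen_lt_grandMax (N : ℕ) (F : 𝓢'(Rn n, ℂ)) (a : ℝ≥0∞) :
    IsOpen {x | a < grandMax N F x} := by
  have : {x | a < grandMax N F x} =
      ⋃ (Φ : 𝓢(Rn n, ℂ)) (_ : Φ ∈ unitS n N) (t : Ioi (0 : ℝ)),
        {x | a < ‖F (dilTrans Φ t x)‖ₑ} := by
    ext x
    simp [grandMax, radialMax, lt_iSup_iff]
  rw [this]
  exact isOpen_iUnion fun Φ => isOpen_iUnion fun _ => isOpen_iUnion fun t =>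
    isOpen_lt continuous_const (continuous_apply_dilTrans F Φ t).enorm

theorem measurable_grandMax (N : ℕ) (F : 𝓢'(Rn n, ℂ)) : Measurable (grandMax N F) :=
  measurable_of_Ioi fun a => (isOpen_lt_grandMax N F a).measurableSet

/-- A locally integrable function is dominated almost everywhere by the grand maximal function. -/
theorem exists_enorm_le_grandMax (n N : ℕ) :
    ∃ C : ℝ, 0 < C ∧ ∀ (F : 𝓢'(Rn n, ℂ)) (f : Rn n → ℂ), IsLocIntegrableRep F f →
      ∀ᵐ x, ‖f x‖ₑ ≤ ENNReal.ofReal C * grandMax N F x := by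
  let β : ContDiffBump (0 : Rn n) := ⟨1, 2, one_pos, one_lt_two⟩
  set I : ℝ := ∫ y, β y with hI
  have hI0 : 0 < I := β.integral_pos
  let ψf : Rn n → ℂ := fun y => ((I⁻¹ * β y : ℝ) : ℂ)
  have hψs : ContDiff ℝ ∞ ψf := Complex.ofRealCLM.contDiff.comp (contDiff_const.mul β.contDiff)
  have hψc : HasCompactSupport ψf :=
    (β.hasCompactSupport.mul_left (f := fun _ => I⁻¹)).comp_left (g := ((↑) : ℝ → ℂ)) rfl
  let ψ : 𝓢(Rn n, ℂ) := hψc.toSchwartzMap hψs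
  obtain ⟨S, hS0, hS⟩ := exists_schwartz_bound ψ N N
  refine ⟨S, hS0, fun F f hF => ?_⟩
  have htpos : ∀ i : ℕ, (0 : ℝ) < 1 / ((i : ℝ) + 1) := fun i => by positivity
  let φ : ℕ → ContDiffBump (0 : Rn n) := fun i =>
    ⟨1 / ((i : ℝ) + 1), 2 * (1 / ((i : ℝ) + 1)), htpos i, by linarith [htpos i]⟩
  -- The profile of a `ContDiffBump` depends only on the ratio of its radii. This ratio is 2
  -- throughout, so all these bumps are dilates of β.
  have hφ : ∀ i y, φ i y = β ((1 / ((i : ℝ) + 1))⁻¹ • y) := by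
    intro i y
    change (someContDiffBumpBase (Rn n)).toFun (2 * (1 / ((i : ℝ) + 1)) / (1 / ((i : ℝ) + 1)))
      ((1 / ((i : ℝ) + 1))⁻¹ • (y - 0)) = (someContDiffBumpBase (Rn n)).toFun (2 / 1)
      ((1 : ℝ)⁻¹ • ((1 / ((i : ℝ) + 1))⁻¹ • y - 0))
    rw [mul_div_assoc, div_self (htpos i).ne', sub_zero, sub_zero, inv_one, one_smul]
    simp
  -- Lebesgue differentiation: the mollifications of f tend to f almost everywhere, and each is a
  -- value of F on a dilate of the fixed function ψ.
  have hlim := ContDiffBump.ae_convolution_tendsto_right_of_locallyIntegrable (μ := volume)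
    (φ := φ) (l := Filter.atTop) (K := 2) (g := f)
    (by
      have := tendsto_one_div_add_atTop_nhds_zero_nat (𝕜 := ℝ)
      have h2 := this.const_mul 2
      rw [mul_zero] at h2
      exact h2)
    (Filter.Eventually.of_forall fun i => le_rfl) hF.1
  filter_upwards [hlim] with x hx
  refine le_of_tendsto hx.enorm (Filter.Eventually.of_forall fun i => ?_)
  set t : Ioi (0 : ℝ) := ⟨1 / ((i : ℝ) + 1), htpos i⟩ with ht
  have hint : ∫ y, φ i y = (t : ℝ) ^ n * I := by
    simp only [hφ]
    have := Measure.integral_comp_inv_smul (volume : Measure (Rn n)) (fun y => β y)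
      (1 / ((i : ℝ) + 1))
    rw [this, finrank_euclideanSpace_fin, abs_of_pos (pow_pos (htpos i) n), smul_eq_mul]
  have e1 : ∀ y, dilTrans ψ t x y = (((φ i).normed volume (x - y) : ℝ) : ℂ) := by
    intro y
    rw [dilTrans_apply, ContDiffBump.normed_def, hint, hφ]
    change _ * (((I⁻¹ * β _ : ℝ)) : ℂ) = _
    rw [← Complex.ofReal_mul]
    have : (t : ℝ) ^ n ≠ 0 := (pow_pos t.2 n).ne'
    change (((t : ℝ) ^ n)⁻¹ * (I⁻¹ * β ((t : ℝ)⁻¹ • (x - y))) : ℝ) =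
      ((β ((t : ℝ)⁻¹ • (x - y)) / ((t : ℝ) ^ n * I) : ℝ) : ℂ)
    congr 1
    generalize β ((t : ℝ)⁻¹ • (x - y)) = w
    field_simp
  have hcs : HasCompactSupport (dilTrans ψ t x : Rn n → ℂ) := by
    have e2 : (dilTrans ψ t x : Rn n → ℂ) =
        fun y => (((φ i).normed volume (x - y) : ℝ) : ℂ) := funext e1
    rw [e2]
    refine HasCompactSupport.comp_left (g := ((↑) : ℝ → ℂ)) ?_ rfl
    exact ((φ i).hasCompactSupport_normed (μ := volume)).comp_homeomorph (Homeomorph.subLeft x)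
  have e3 := hF.2 (dilTrans ψ t x) hcs
  have e4 : convolution ((φ i).normed volume) f (ContinuousLinearMap.lsmul ℝ ℝ) volume x =
      F (dilTrans ψ t x) := by
    rw [e3, convolution_eq_swap]
    refine integral_congr_ae (Filter.Eventually.of_forall fun y => ?_)
    simp only [ContinuousLinearMap.lsmul_apply, e1]
    exact Complex.real_smul
  rw [e4]
  exact enorm_apply_dilTrans_le F hS0 hS t x

end Schwartz

/-! ### Cubes and the Whitney covering -/

section Cubes

variable {n : ℕ}

theorem norm_le_of_forall_abs_le {x : Rn n} {a : ℝ} (ha : 0 ≤ a) (h : ∀ i, |x i| ≤ a) :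
    ‖x‖ ≤ n * a := by
  rw [EuclideanSpace.norm_eq]
  refine Real.sqrt_le_iff.2 ⟨by positivity, ?_⟩
  calc ∑ i, ‖x i‖ ^ 2 ≤ ∑ _i : Fin n, a ^ 2 := by
        refine Finset.sum_le_sum fun i _ => ?_
        rw [Real.norm_eq_abs]
        exact pow_le_pow_left₀ (abs_nonneg _) (h i) 2
    _ = n * a ^ 2 := by simp
    _ ≤ (n * a) ^ 2 := by
      have h1 : (n : ℝ) ≤ (n : ℝ) ^ 2 := by
        exact_mod_cast Nat.le_self_pow (by norm_num) n
      rw [mul_pow]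
      gcongr

theorem norm_sub_le_of_mem_cube {c x : Rn n} {ℓ : ℝ} (hℓ : 0 ≤ ℓ) (hx : x ∈ cube c ℓ) :
    ‖x - c‖ ≤ n * (ℓ / 2) :=
  norm_le_of_forall_abs_le (by positivity) hx

theorem closedBall_subset_cube (c : Rn n) {r ℓ : ℝ} (h : 2 * r ≤ ℓ) :
    Metric.closedBall c r ⊆ cube c ℓ := by
  intro x hx i
  have h1 : |(x - c) i| ≤ ‖x - c‖ := PiLp.norm_apply_le (x - c) i
  rw [Metric.mem_closedBall, dist_eq_norm] at hx
  have h2 : (x - c) i = x i - c i := rfl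
  rw [h2] at h1
  linarith

theorem isClosed_cube (c : Rn n) (ℓ : ℝ) : IsClosed (cube c ℓ) := by
  have : cube c ℓ = ⋂ i, {x : Rn n | |x i - c i| ≤ ℓ / 2} := by
    ext x; simp [cube]
  rw [this]
  exact isClosed_iInter fun i => isClosed_le (by fun_prop) continuous_const

theorem measurableSet_cube (c : Rn n) (ℓ : ℝ) : MeasurableSet (cube c ℓ) :=
  (isClosed_cube c ℓ).measurableSet

theorem volume_cube (c : Rn n) (ℓ : ℝ) : volume (cube c ℓ) = ENNReal.ofReal ℓ ^ n := by
  have h := (EuclideanSpace.volume_preserving_symm_measurableEquiv_toLp (Fin n)).measure_preimage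
    (s := Icc (fun i => c i - ℓ / 2) (fun i => c i + ℓ / 2)) measurableSet_Icc.nullMeasurableSet
  have e : (MeasurableEquiv.toLp 2 (Fin n → ℝ)).symm ⁻¹'
      Icc (fun i => c i - ℓ / 2) (fun i => c i + ℓ / 2) = cube c ℓ := by
    ext x
    simp only [mem_preimage, mem_Icc, Pi.le_def, cube, mem_ofPred_eq, abs_le]
    constructor
    · rintro ⟨h1, h2⟩ i
      have := h1 i
      have := h2 i
      simp only [MeasurableEquiv.coe_toLp_symm] at *
      constructor <;> linarith
    · intro h
      constructor <;> intro i <;> have := h i <;> simp only [MeasurableEquiv.coe_toLp_symm] <;>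
        linarith
  rw [e] at h
  rw [h, Real.volume_Icc_pi]
  simp only [add_sub_sub_cancel, add_halves, Finset.prod_const, Finset.card_univ, Fintype.card_fin]

/-- A Whitney covering of an open set by cubes with bounded overlap. -/
theorem exists_whitney (hn : 1 ≤ n) : ∃ A : ℕ, ∀ Ω : Set (Rn n), IsOpen Ω → (Ωᶜ).Nonempty →
    ∃ (ι : Type) (_ : Countable ι) (z : ι → Rn n) (ℓ : ι → ℝ), (∀ k, 0 < ℓ k) ∧
      (∀ k, 8 * (n : ℝ) ^ 2 * ℓ k ≤ Metric.infDist (z k) Ωᶜ) ∧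
      (∀ k, Metric.infDist (z k) Ωᶜ < 40 * (n : ℝ) ^ 2 * ℓ k) ∧
      (∀ x ∈ Ω, ∃ k, x ∈ Metric.closedBall (z k) (n * ℓ k)) ∧
      ∀ x, {k | x ∈ cube (z k) (8 * n * ℓ k)}.encard ≤ A := by
  have hn1 : (1 : ℝ) ≤ n := by exact_mod_cast hn
  -- The cubes through a point have at most 7 different levels relative to one of them, and at each
  -- level at most 8n + 1 positions per coordinate.
  let T : Finset (ℤ × (Fin n → ℤ)) :=
    Finset.Ioo (-4) 4 ×ˢ Fintype.piFinset (fun _ => Finset.Icc 0 (8 * (n : ℤ)))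
  refine ⟨T.card, fun Ω hΩ hne => ?_⟩
  let pt : ℤ × (Fin n → ℤ) → Rn n := fun q => WithLp.toLp 2 (fun i => (2 : ℝ) ^ q.1 * q.2 i)
  -- All dyadic grid points whose mesh is comparable to their distance from the complement; no
  -- maximality or disjointness is imposed.
  let ι : Type := {q : ℤ × (Fin n → ℤ) //
    8 * (n : ℝ) ^ 2 * 2 ^ q.1 ≤ Metric.infDist (pt q) Ωᶜ ∧
      Metric.infDist (pt q) Ωᶜ < 40 * (n : ℝ) ^ 2 * 2 ^ q.1}
  have hpos : ∀ j : ℤ, (0 : ℝ) < 2 ^ j := fun j => by positivity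
  refine ⟨ι, inferInstance, fun k => pt k.1, fun k => 2 ^ k.1.1, fun k => hpos _,
    fun k => k.2.1, fun k => k.2.2, ?_, ?_⟩
  · intro x hx
    have hδ : 0 < Metric.infDist x Ωᶜ :=
      (hΩ.isClosed_compl.notMem_iff_infDist_pos hne).1 (by simpa using hx)
    set δ := Metric.infDist x Ωᶜ
    -- This puts δ in [16n²L, 32n²L). Rounding x to the grid of mesh L changes the distance by at
    -- most n²L, well within the window from 8n²L to 40n²L.
    obtain ⟨j, hj1, hj2⟩ := exists_mem_Ico_zpow (x := δ / (16 * (n : ℝ) ^ 2)) (y := (2 : ℝ))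
      (by positivity) one_lt_two
    rw [le_div_iff₀ (by positivity)] at hj1
    rw [div_lt_iff₀ (by positivity), zpow_add_one₀ two_ne_zero] at hj2
    set L : ℝ := 2 ^ j with hL
    have hL0 : 0 < L := hpos j
    let q : ℤ × (Fin n → ℤ) := (j, fun i => round (x i / L))
    have hq : ‖x - pt q‖ ≤ n * (L / 2) := by
      refine norm_le_of_forall_abs_le (by positivity) fun i => ?_
      change |x i - L * (round (x i / L) : ℤ)| ≤ L / 2
      have h1 := abs_sub_round (x i / L)
      have h2 : x i - L * (round (x i / L) : ℤ) = L * (x i / L - round (x i / L)) := by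
        field_simp
      rw [h2, abs_mul, abs_of_pos hL0]
      nlinarith
    have hd1 : δ ≤ Metric.infDist (pt q) Ωᶜ + n * (L / 2) :=
      (Metric.infDist_le_infDist_add_dist (y := pt q)).trans (by rw [dist_eq_norm]; linarith)
    have hd2 : Metric.infDist (pt q) Ωᶜ ≤ δ + n * (L / 2) :=
      (Metric.infDist_le_infDist_add_dist (y := x)).trans
        (by rw [dist_comm, dist_eq_norm]; linarith)
    have hnL : n * (L / 2) ≤ (n : ℝ) ^ 2 * L := by nlinarith [mul_pos (zero_lt_one.trans_le hn1) hL0]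
    refine ⟨⟨q, ?_, ?_⟩, ?_⟩
    · change 8 * (n : ℝ) ^ 2 * L ≤ _
      nlinarith
    · change _ < 40 * (n : ℝ) ^ 2 * L
      nlinarith
    · rw [Metric.mem_closedBall, dist_eq_norm]
      refine hq.trans ?_
      change n * (L / 2) ≤ n * L
      nlinarith
  · intro x
    rcases Set.eq_empty_or_nonempty {k : ι | x ∈ cube (pt k.1) (8 * n * 2 ^ k.1.1)} with h | h
    · rw [h]; simp
    obtain ⟨k₀, hk₀⟩ := h
    -- A point of the cube is within 4n²·2^j of its centre, so the window 8 to 40 becomes 4 to 44.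
    -- The ratio 11 is below 2⁴, hence the level bound in `hcomp`.
    have hdist : ∀ k : ι, x ∈ cube (pt k.1) (8 * n * 2 ^ k.1.1) →
        4 * (n : ℝ) ^ 2 * 2 ^ k.1.1 ≤ Metric.infDist x Ωᶜ ∧
          Metric.infDist x Ωᶜ < 44 * (n : ℝ) ^ 2 * 2 ^ k.1.1 := by
      intro k hk
      have h1 := norm_sub_le_of_mem_cube (by positivity) hk
      have h2 := k.2.1
      have h3 := k.2.2
      have h4 : Metric.infDist x Ωᶜ ≤ Metric.infDist (pt k.1) Ωᶜ + dist x (pt k.1) :=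
        Metric.infDist_le_infDist_add_dist
      have h5 : Metric.infDist (pt k.1) Ωᶜ ≤ Metric.infDist x Ωᶜ + dist (pt k.1) x :=
        Metric.infDist_le_infDist_add_dist
      rw [dist_comm (pt k.1)] at h5
      rw [← dist_eq_norm] at h1
      constructor <;> nlinarith
    have hcomp : ∀ k k' : ι, x ∈ cube (pt k.1) (8 * n * 2 ^ k.1.1) →
        x ∈ cube (pt k'.1) (8 * n * 2 ^ k'.1.1) → k.1.1 < k'.1.1 + 4 := by
      intro k k' hk hk'
      have h1 := (hdist k hk).1
      have h2 := (hdist k' hk').2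
      have h3 : (2 : ℝ) ^ k.1.1 < 2 ^ (k'.1.1 + 4) := by
        rw [zpow_add₀ two_ne_zero]
        have h4 : 4 * (n : ℝ) ^ 2 * 2 ^ k.1.1 < 4 * (n : ℝ) ^ 2 * (2 ^ k'.1.1 * 2 ^ (4 : ℤ)) := by
          have : (2 : ℝ) ^ (4 : ℤ) = 16 := by norm_num
          rw [this]
          have h5 : (0 : ℝ) < (n : ℝ) ^ 2 * 2 ^ k'.1.1 := by positivity
          nlinarith
        exact lt_of_mul_lt_mul_left h4 (by positivity)
      exact (zpow_lt_zpow_iff_right₀ one_lt_two).1 h3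
    have hcoord : ∀ k : ι, x ∈ cube (pt k.1) (8 * n * 2 ^ k.1.1) → ∀ i,
        |x i / 2 ^ k.1.1 - k.1.2 i| ≤ 4 * n := by
      intro k hk i
      have h1 : |x i - 2 ^ k.1.1 * k.1.2 i| ≤ 8 * n * 2 ^ k.1.1 / 2 := hk i
      have h2 : x i - 2 ^ k.1.1 * k.1.2 i = 2 ^ k.1.1 * (x i / 2 ^ k.1.1 - k.1.2 i) := by
        field_simp
      rw [h2, abs_mul, abs_of_pos (hpos _)] at h1
      have := hpos k.1.1
      nlinarith
    -- Level relative to `k₀`, and grid position counted from the least admissible integer in each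
    -- coordinate.
    let m : ι → ℤ × (Fin n → ℤ) := fun k =>
      (k.1.1 - k₀.1.1, fun i => k.1.2 i - ⌈x i / 2 ^ k.1.1 - 4 * n⌉)
    have hmaps : ∀ k ∈ {k : ι | x ∈ cube (pt k.1) (8 * n * 2 ^ k.1.1)}, m k ∈ (T : Set _) := by
      intro k hk
      simp only [T, m, Finset.coe_product, mem_prod, Finset.coe_Ioo, mem_Ioo, Finset.mem_coe,
        Fintype.mem_piFinset, Finset.mem_Icc]
      refine ⟨⟨by have := hcomp k₀ k hk₀ hk; omega, by have := hcomp k k₀ hk hk₀; omega⟩,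
        fun i => ?_⟩
      have h1 := abs_le.1 (hcoord k hk i)
      constructor
      · have : ⌈x i / 2 ^ k.1.1 - 4 * n⌉ ≤ k.1.2 i := Int.ceil_le.2 (by linarith [h1.1, h1.2])
        linarith
      · have h2 := Int.le_ceil (x i / 2 ^ k.1.1 - 4 * n)
        have h3 : ((k.1.2 i : ℤ) : ℝ) ≤ ((8 * (n : ℤ) + ⌈x i / 2 ^ k.1.1 - 4 * n⌉ : ℤ) : ℝ) := by
          push_cast; linarith [h1.1, h1.2]
        have h4 := Int.cast_le.1 h3
        linarith
    have hinj : Set.InjOn m {k : ι | x ∈ cube (pt k.1) (8 * n * 2 ^ k.1.1)} := by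
      intro k _ k' _ h
      simp only [m, Prod.mk.injEq] at h
      have h1 : k.1.1 = k'.1.1 := by omega
      refine Subtype.ext (Prod.ext h1 (funext fun i => ?_))
      have h2 := congrFun h.2 i
      simp only [h1] at h2
      omega
    have := Set.encard_le_encard_of_injOn hmaps hinj
    rw [Set.encard_coe_eq_coe_finsetCard] at this
    exact this

end Cubes

/-! ### Smooth partition of unity -/

section Partition

variable {n : ℕ}

theorem ScaleBound.rescale {E : Type} [NormedAddCommGroup E] [NormedSpace ℝ E] {N : ℕ}
    {ℓ B a : ℝ} (ha : 1 ≤ a) (hℓ : 0 < ℓ) {η : E → ℂ} {y : E}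
    (h : ScaleBound N (ℓ / a) B η y) : ScaleBound N ℓ (a ^ N * B) η y := by
  intro m hm
  refine (h m hm).trans ?_
  have hB := h.nonneg
  have h1 : a ^ m ≤ a ^ N := pow_le_pow_right₀ ha hm
  rw [inv_div, div_pow]
  calc B * (a ^ m / ℓ ^ m) = a ^ m * B * ℓ⁻¹ ^ m := by rw [inv_pow]; ring
    _ ≤ _ := by gcongr

/-- A smooth partition of unity subordinate to a family of balls with bounded overlap and
comparable radii. -/
theorem exists_partition (hn : 1 ≤ n) (N A : ℕ) : ∃ B : ℝ, 0 < B ∧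
    ∀ (ι : Type) [Countable ι] (z : ι → Rn n) (ℓ : ι → ℝ), (∀ k, 0 < ℓ k) →
      (∀ x, {k | x ∈ Metric.closedBall (z k) (2 * n * ℓ k)}.encard ≤ A) →
      (∀ j k y, y ∈ Metric.closedBall (z j) (2 * n * ℓ j) →
        y ∈ Metric.closedBall (z k) (2 * n * ℓ k) → ℓ k ≤ 16 * ℓ j) →
      ∃ η : ι → Rn n → ℂ, (∀ k, ContDiff ℝ ∞ (η k)) ∧
        (∀ k, tsupport (η k) ⊆ Metric.closedBall (z k) (2 * n * ℓ k)) ∧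
        (∀ k y, ScaleBound N (ℓ k) B (η k) y) ∧
        ∀ x, (∃ k, x ∈ Metric.closedBall (z k) (n * ℓ k)) → HasSum (fun k => η k x) 1 := by
  have hn1 : (1 : ℝ) ≤ n := by exact_mod_cast hn
  let β : ContDiffBump (0 : Rn n) := ⟨n, 2 * n, by positivity, by linarith⟩
  let ψf : Rn n → ℂ := fun y => ((β y : ℝ) : ℂ)
  have hψs : ContDiff ℝ ∞ ψf := Complex.ofRealCLM.contDiff.comp β.contDiff
  have hψc : HasCompactSupport ψf := β.hasCompactSupport.comp_left (g := ((↑) : ℝ → ℂ)) rfl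
  obtain ⟨S, hS0, hS⟩ := exists_schwartz_bound (hψc.toSchwartzMap hψs) 0 N
  simp only [pow_zero, one_mul] at hS
  change ∀ m ≤ N, ∀ x, ‖iteratedFDeriv ℝ m ψf x‖ ≤ S at hS
  -- The product estimate is made at the scale ℓ_k/16, which no active neighbour undercuts;
  -- returning to ℓ_k costs `16 ^ N`. The exponent `A` bounds the number of active factors.
  refine ⟨16 ^ N * (2 ^ N * S * (2 ^ N * (1 + S)) ^ A), by positivity, ?_⟩
  intro ι _ z ℓ hℓ hA hcomp
  classical
  obtain ⟨e, he⟩ := Countable.exists_injective_nat ι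
  let φ : ι → Rn n → ℂ := fun k y => ψf ((ℓ k)⁻¹ • (z k - y))
  have hφs : ∀ k, ContDiff ℝ ∞ (φ k) := fun k =>
    hψs.comp (by fun_prop : ContDiff ℝ ∞ fun y : Rn n => (ℓ k)⁻¹ • (z k - y))
  have hφb : ∀ k y, ScaleBound N (ℓ k) S (φ k) y := by
    intro k y m hm
    rw [norm_iteratedFDeriv_dil hψs (z k) (hℓ k), mul_comm]
    have := inv_pos.2 (hℓ k)
    gcongr
    exact hS m hm _
  have hnorm : ∀ k y, ‖(ℓ k)⁻¹ • (z k - y)‖ = dist y (z k) / ℓ k := by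
    intro k y
    rw [norm_smul, norm_inv, Real.norm_of_nonneg (hℓ k).le, dist_comm, dist_eq_norm]
    ring
  have hφ0 : ∀ k y, y ∉ Metric.closedBall (z k) (2 * n * ℓ k) → φ k y = 0 := by
    intro k y hy
    have : β ((ℓ k)⁻¹ • (z k - y)) = 0 := by
      refine β.zero_of_le_dist ?_
      rw [dist_zero_right, hnorm, le_div_iff₀ (hℓ k)]
      exact (not_le.1 hy).le
    simp only [φ, ψf, this, Complex.ofReal_zero]
  have hφ1 : ∀ k y, y ∈ Metric.closedBall (z k) (n * ℓ k) → φ k y = 1 := by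
    intro k y hy
    have : β ((ℓ k)⁻¹ • (z k - y)) = 1 := by
      refine β.one_of_mem_closedBall ?_
      rw [Metric.mem_closedBall, dist_zero_right, hnorm, div_le_iff₀ (hℓ k)]
      exact hy
    simp only [φ, ψf, this, Complex.ofReal_one]
  have hts : ∀ k, tsupport (φ k) ⊆ Metric.closedBall (z k) (2 * n * ℓ k) := fun k =>
    closure_minimal (fun y hy => by
      by_contra h
      exact hy (hφ0 k y h)) Metric.isClosed_closedBall
  have h1s : ∀ k, ContDiff ℝ ∞ (fun y => 1 - φ k y) := fun k => contDiff_const.sub (hφs k)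
  have h1b : ∀ k y, ScaleBound N (ℓ k) (1 + S) (fun y => 1 - φ k y) y := by
    intro k y m hm
    have e1 := fun_iteratedFDeriv_sub_apply (𝕜 := ℝ) (i := m) (x := y)
      (f := fun _ => (1 : ℂ)) contDiffAt_const
      (((hφs k).of_le (natCast_le_smooth m)).contDiffAt)
    have e2 := hφb k y m hm
    rw [e1]
    refine (norm_sub_le _ _).trans ?_
    have e3 : ‖iteratedFDeriv ℝ m (fun _ : Rn n => (1 : ℂ)) y‖ ≤ 1 * (ℓ k)⁻¹ ^ m := by
      rcases Nat.eq_zero_or_pos m with rfl | h0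
      · simp
      · rw [iteratedFDeriv_const_of_ne (by omega)]
        have := hℓ k
        simp; positivity
    linarith
  have hfin : ∀ k, {j | e j < e k}.Finite := fun k =>
    (Set.finite_Iio (e k)).preimage he.injOn
  let P : ι → Finset ι := fun k => (hfin k).toFinset
  have hP : ∀ k j, j ∈ P k ↔ e j < e k := fun k j => by simp [P]
  -- The sum of these telescopes to 1 − ∏(1 − φ_j), and the product has a zero factor wherever some
  -- φ_k is 1. No division is involved, so no lower bound for ∑ φ_k is needed. The enumeration `e`
  -- makes each product finite.
  let η : ι → Rn n → ℂ := fun k y => φ k y * ∏ j ∈ P k, (1 - φ j y)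
  have hactive : ∀ x, {k | x ∈ Metric.closedBall (z k) (2 * n * ℓ k)}.Finite := fun x =>
    Set.finite_of_encard_le_coe (hA x)
  have hηts : ∀ k, tsupport (η k) ⊆ tsupport (φ k) := fun k =>
    tsupport_mul_subset_left
  refine ⟨η, fun k => (hφs k).mul (contDiff_prod fun j _ => h1s j),
    fun k => (hηts k).trans (hts k), ?_, ?_⟩
  · intro k y
    by_cases hy : y ∈ tsupport (φ k)
    · refine ScaleBound.rescale (by norm_num) (hℓ k) ?_
      have h16 : 0 < ℓ k / 16 := by linarith [hℓ k]
      let Q : Finset ι := {j ∈ P k | y ∈ Metric.closedBall (z j) (2 * n * ℓ j)}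
      have hQ : Q.card ≤ A := by
        have h1 : (Q : Set ι) ⊆ {k | y ∈ Metric.closedBall (z k) (2 * n * ℓ k)} := fun j hj =>
          (Finset.mem_filter.1 hj).2
        have h2 := (Set.encard_le_encard h1).trans (hA y)
        rw [Set.encard_coe_eq_coe_finsetCard] at h2
        exact_mod_cast h2
      have hbQ : ScaleBound N (ℓ k / 16) ((2 ^ N * (1 + S)) ^ A)
          (fun y => ∏ j ∈ Q, (1 - φ j y)) y := by
        refine ScaleBound.prod (η := fun j y => 1 - φ j y) (by linarith) h16 Q
          (fun j _ => h1s j) (fun j hj => ?_) hQ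
        refine (h1b j y).mono h16 ?_ le_rfl
        have := hcomp j k y (Finset.mem_filter.1 hj).2 (hts k hy)
        linarith
      have hmul := ScaleBound.mul h16 (hφs k) (contDiff_prod fun j _ => h1s j)
        ((hφb k y).mono h16 (by linarith [hℓ k]) le_rfl) hbQ
      refine hmul.congr ?_
      -- Derivatives see a whole neighbourhood of y. The inactive φ_j vanish there, since their
      -- supporting balls are closed and the product is finite.
      have hev : ∀ᶠ w in nhds y, ∀ j ∈ P k, j ∉ Q → φ j w = 0 := by
        refine (Finset.eventually_all (P k)).2 fun j hj => ?_
        by_cases hjQ : j ∈ Q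
        · exact Filter.Eventually.of_forall fun w h => absurd hjQ h
        · have : y ∈ (Metric.closedBall (z j) (2 * n * ℓ j))ᶜ := fun h =>
            hjQ (Finset.mem_filter.2 ⟨hj, h⟩)
          filter_upwards [Metric.isClosed_closedBall.isOpen_compl.mem_nhds this] with w hw _
          exact hφ0 j w hw
      filter_upwards [hev] with w hw
      simp only [η]
      congr 1
      symm
      refine Finset.prod_subset (Finset.filter_subset _ _) fun j hj hjQ => ?_
      rw [hw j hj hjQ, sub_zero]
    · exact ScaleBound.of_notMem_tsupport (hℓ k) (by positivity) fun h => hy (hηts k h)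
  · rintro x ⟨k₀, hk₀⟩
    let _ : LinearOrder ι := LinearOrder.lift' e he
    let J : Finset ι := (hactive x).toFinset
    have hJ : ∀ k, k ∉ J → φ k x = 0 := fun k hk => hφ0 k x (by simpa [J] using hk)
    have hs : ∑ k ∈ J, η k x = 1 := by
      have h1 := Finset.prod_one_sub_ordered J (fun k => φ k x)
      have h2 : ∏ k ∈ J, (1 - φ k x) = 0 := by
        have hk : k₀ ∈ J := by
          by_contra h
          have := hJ k₀ h
          rw [hφ1 k₀ x hk₀] at this
          exact one_ne_zero this
        refine Finset.prod_eq_zero hk ?_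
        rw [hφ1 k₀ x hk₀, sub_self]
      rw [h2] at h1
      refine Eq.trans ?_ (sub_eq_zero.1 h1.symm).symm
      refine Finset.sum_congr rfl fun k _ => ?_
      simp only [η]
      congr 1
      symm
      refine Finset.prod_subset (fun j hj => ?_) fun j hj hj' => ?_
      · exact (hP k j).2 (Finset.mem_filter.1 hj).2
      · have : j ∉ J := fun h => hj' (Finset.mem_filter.2 ⟨h, (hP k j).1 hj⟩)
        rw [hJ j this, sub_zero]
    rw [← hs]
    refine hasSum_sum_of_ne_finset_zero fun k hk => ?_
    simp only [η, hJ k hk, zero_mul]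

end Partition

/-! ### Bounded functions with prescribed moments -/

section Duals

/-- Bounded functions on `[-1/2, 1/2]` that are dual to the monomials of degree at most `d`. -/
theorem exists_dual_monomials_real (d : ℕ) : ∃ (T : ℝ) (θ : Fin (d + 1) → ℝ → ℝ), 0 < T ∧
    (∀ j, Measurable (θ j)) ∧ (∀ j t, |θ j t| ≤ T) ∧ (∀ j t, 1 / 2 < |t| → θ j t = 0) ∧
    ∀ i j : Fin (d + 1), ∫ t, θ j t * t ^ (i : ℕ) = if j = i then 1 else 0 := by
  classical
  -- The Gram matrix of the monomials on [−1/2, 1/2]. A kernel vector is a polynomial of zero L²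
  -- norm, hence zero, so the matrix is invertible and each dual function is a truncated polynomial.
  let G : Matrix (Fin (d + 1)) (Fin (d + 1)) ℝ :=
    Matrix.of fun j i => ∫ t in (-1 / 2 : ℝ)..(1 / 2), t ^ ((i : ℕ) + (j : ℕ))
  have hG : ∀ a j, G.mulVec a j =
      ∫ t in (-1 / 2 : ℝ)..(1 / 2), (∑ i, a i * t ^ (i : ℕ)) * t ^ (j : ℕ) := by
    intro a j
    have e : ∀ t : ℝ, (∑ i, a i * t ^ (i : ℕ)) * t ^ (j : ℕ) =
        ∑ i, a i * t ^ ((i : ℕ) + (j : ℕ)) := by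
      intro t; rw [Finset.sum_mul]; exact Finset.sum_congr rfl fun i _ => by rw [pow_add]; ring
    simp only [e]
    rw [intervalIntegral.integral_finsetSum
      fun i _ => Continuous.intervalIntegrable (by fun_prop) _ _]
    simp only [intervalIntegral.integral_const_mul, Matrix.mulVec, dotProduct, G, Matrix.of_apply]
    exact Finset.sum_congr rfl fun i _ => mul_comm _ _
  have hinj : Function.Injective G.mulVecLin := by
    rw [← LinearMap.ker_eq_bot, LinearMap.ker_eq_bot']
    intro a ha
    by_contra hne
    have h0 : ∫ t in (-1 / 2 : ℝ)..(1 / 2), (∑ i, a i * t ^ (i : ℕ)) ^ 2 = 0 := by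
      have e : ∀ t : ℝ, (∑ i, a i * t ^ (i : ℕ)) ^ 2 =
          ∑ j, a j * ((∑ i, a i * t ^ (i : ℕ)) * t ^ (j : ℕ)) := by
        intro t
        rw [sq]
        conv_lhs => rw [Finset.mul_sum]
        exact Finset.sum_congr rfl fun i _ => by ring
      simp only [e]
      rw [intervalIntegral.integral_finsetSum
        fun i _ => Continuous.intervalIntegrable (by fun_prop) _ _]
      refine Finset.sum_eq_zero fun j _ => ?_
      rw [intervalIntegral.integral_const_mul, ← hG]
      have := congrFun ha j
      simp only [Matrix.mulVecLin_apply, Pi.zero_apply] at this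
      rw [this, mul_zero]
    let p : Polynomial ℝ := ∑ i : Fin (d + 1), Polynomial.C (a i) * Polynomial.X ^ (i : ℕ)
    have hp : ∀ t, p.eval t = ∑ i, a i * t ^ (i : ℕ) := by
      intro t; simp [p, Polynomial.eval_finsetSum]
    have hp0 : p ≠ 0 := by
      intro h
      refine hne (funext fun i => ?_)
      have h1 := congrArg (fun q => Polynomial.coeff q (i : ℕ)) h
      simp only [p, Polynomial.finsetSum_coeff, Polynomial.coeff_C_mul, Polynomial.coeff_X_pow,
        Polynomial.coeff_zero] at h1
      rw [Finset.sum_eq_single i] at h1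
      · simpa using h1
      · intro b _ hb
        rw [if_neg (fun h => hb (Fin.ext h.symm)), mul_zero]
      · simp
    have hex : ∃ c ∈ Icc (-1 / 2 : ℝ) (1 / 2), p.eval c ≠ 0 := by
      by_contra hcon
      push Not at hcon
      refine hp0 (Polynomial.eq_zero_of_infinite_isRoot p ?_)
      exact (Set.Icc_infinite (by norm_num : (-1 / 2 : ℝ) < 1 / 2)).mono fun t ht => hcon t ht
    obtain ⟨c, hc, hc0⟩ := hex
    have := intervalIntegral.integral_pos (f := fun t => (∑ i, a i * t ^ (i : ℕ)) ^ 2)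
      (by norm_num : (-1 / 2 : ℝ) < 1 / 2) (by fun_prop) (fun t _ => sq_nonneg _)
      ⟨c, hc, by rw [hp] at hc0; positivity⟩
    linarith
  have hsurj : Function.Surjective G.mulVecLin := LinearMap.injective_iff_surjective.1 hinj
  choose a ha using fun j : Fin (d + 1) => hsurj (Pi.single j 1)
  have habs : ∀ t : ℝ, t ∈ Ioc (-1 / 2 : ℝ) (1 / 2) → |t| ≤ 1 := by
    intro t ht
    rw [abs_le]
    constructor <;> linarith [ht.1, ht.2]
  refine ⟨∑ j, ∑ i, |a j i| + 1,
    fun j => (Ioc (-1 / 2 : ℝ) (1 / 2)).indicator fun t => ∑ i, a j i * t ^ (i : ℕ),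
    by positivity, ?_, ?_, ?_, ?_⟩
  · intro j
    exact (Continuous.measurable (by fun_prop)).indicator measurableSet_Ioc
  · intro j t
    by_cases ht : t ∈ Ioc (-1 / 2 : ℝ) (1 / 2)
    · simp only [indicator_of_mem ht]
      have h1 : |∑ i, a j i * t ^ (i : ℕ)| ≤ ∑ i, |a j i| := by
        refine (Finset.abs_sum_le_sum_abs _ _).trans (Finset.sum_le_sum fun i _ => ?_)
        rw [abs_mul, abs_pow]
        exact mul_le_of_le_one_right (abs_nonneg _) (pow_le_one₀ (abs_nonneg _) (habs t ht))
      have h2 : ∑ i, |a j i| ≤ ∑ j, ∑ i, |a j i| :=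
        Finset.single_le_sum (f := fun j => ∑ i, |a j i|)
          (fun j _ => Finset.sum_nonneg fun i _ => abs_nonneg _) (Finset.mem_univ j)
      linarith
    · simp only [indicator_of_notMem ht, abs_zero]; positivity
  · intro j t ht
    refine indicator_of_notMem (fun h => ?_) _
    have : |t| ≤ 1 / 2 := by rw [abs_le]; constructor <;> linarith [h.1, h.2]
    linarith
  · intro i j
    have e : ∀ t : ℝ, (Ioc (-1 / 2 : ℝ) (1 / 2)).indicator (fun t => ∑ i, a j i * t ^ (i : ℕ)) t *
        t ^ (i : ℕ) = (Ioc (-1 / 2 : ℝ) (1 / 2)).indicator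
          (fun t => (∑ i, a j i * t ^ (i : ℕ)) * t ^ (i : ℕ)) t := by
      intro t
      by_cases ht : t ∈ Ioc (-1 / 2 : ℝ) (1 / 2)
      · rw [indicator_of_mem ht, indicator_of_mem ht]
      · rw [indicator_of_notMem ht, indicator_of_notMem ht, zero_mul]
    simp only [e]
    rw [integral_indicator measurableSet_Ioc,
      ← intervalIntegral.integral_of_le (by norm_num : (-1 / 2 : ℝ) ≤ 1 / 2), ← hG]
    have := congrFun (ha j) i
    simp only [Matrix.mulVecLin_apply] at this
    rw [this, Pi.single_apply]
    simp only [eq_comm]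

variable {n : ℕ}

theorem integral_prod_coord (g : Fin n → ℝ → ℝ) :
    ∫ x : Rn n, ∏ i, g i (x i) = ∏ i, ∫ t, g i t := by
  rw [← integral_fintype_prod_volume_eq_prod]
  exact (EuclideanSpace.volume_preserving_symm_measurableEquiv_toLp (Fin n)).integral_comp'
    (fun x => ∏ i, g i (x i))

theorem integral_comp_dil {G : Type} [NormedAddCommGroup G] [NormedSpace ℝ G] (h : Rn n → G)
    (z : Rn n) {ℓ : ℝ} (hℓ : 0 < ℓ) :
    ∫ y, h (ℓ⁻¹ • (y - z)) = ℓ ^ n • ∫ u, h u := by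
  rw [integral_sub_right_eq_self (fun y => h (ℓ⁻¹ • y)) z, Measure.integral_comp_inv_smul,
    finrank_euclideanSpace_fin, abs_of_pos (pow_pos hℓ n)]

/-- The monomial with exponents `β` in the coordinates `(y - z) / ℓ`. -/
noncomputable def scaledMono (z : Rn n) (ℓ : ℝ) (β : Fin n → ℕ) (y : Rn n) : ℂ :=
  ∏ i, (((ℓ⁻¹ • (y - z)) i : ℝ) : ℂ) ^ β i

theorem contDiff_scaledMono (z : Rn n) (ℓ : ℝ) (β : Fin n → ℕ) :
    ContDiff ℝ ∞ (scaledMono z ℓ β) := by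
  unfold scaledMono
  refine contDiff_prod fun i _ => ContDiff.pow ?_ _
  refine Complex.ofRealCLM.contDiff.comp ?_
  have h : ContDiff ℝ ∞ (fun x : Rn n => x i) := (EuclideanSpace.proj i : Rn n →L[ℝ] ℝ).contDiff
  exact h.comp (by fun_prop : ContDiff ℝ ∞ fun y : Rn n => ℓ⁻¹ • (y - z))

/-- A bounded function supported in a cube with prescribed moments. -/
theorem exists_correction (n d : ℕ) : ∃ T : ℝ, 0 < T ∧ ∀ (z : Rn n) (ℓ : ℝ), 0 < ℓ →
    ∀ mom : (Fin n → Fin (d + 1)) → ℂ, ∃ Q : Rn n → ℂ, Measurable Q ∧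
      (∀ y, ‖Q y‖ ≤ T * ∑ α, ‖mom α‖) ∧ (∀ y, y ∉ cube z ℓ → Q y = 0) ∧
      ∀ β : Fin n → Fin (d + 1),
        ∫ y, Q y * scaledMono z ℓ (fun i => β i) y = (ℓ : ℂ) ^ n * mom β := by
  obtain ⟨T, θ, hT, hm, hb, hs, hi⟩ := exists_dual_monomials_real d
  -- Tensor products are dual to all monomials of degree at most `d` in each variable separately, a
  -- box that contains the multi-indices of total degree at most `d`.
  let Θ : (Fin n → Fin (d + 1)) → Rn n → ℝ := fun α u => ∏ i, θ (α i) (u i)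
  have hΘm : ∀ α, Measurable (Θ α) := fun α =>
    Finset.measurable_prod _ fun i _ => (hm (α i)).comp
      ((EuclideanSpace.proj i : Rn n →L[ℝ] ℝ).continuous.measurable)
  have hΘb : ∀ α u, |Θ α u| ≤ T ^ n := by
    intro α u
    rw [Finset.abs_prod]
    calc ∏ i, |θ (α i) (u i)| ≤ ∏ _i : Fin n, T :=
          Finset.prod_le_prod (fun _ _ => abs_nonneg _) fun i _ => hb _ _
      _ = T ^ n := by simp
  have hΘs : ∀ α u, u ∉ cube (0 : Rn n) 1 → Θ α u = 0 := by
    intro α u hu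
    simp only [cube, mem_ofPred_eq, not_forall, not_le] at hu
    obtain ⟨i, hi⟩ := hu
    have hi' : 1 / 2 < |u i| := by simpa using hi
    exact Finset.prod_eq_zero (Finset.mem_univ i) (hs _ _ hi')
  have hΘi : ∀ α β : Fin n → Fin (d + 1),
      ∫ u, Θ α u * ∏ i, u i ^ (β i : ℕ) = if α = β then 1 else 0 := by
    intro α β
    simp only [Θ, ← Finset.prod_mul_distrib]
    rw [integral_prod_coord (fun i t => θ (α i) t * t ^ (β i : ℕ))]
    simp only [hi]
    split_ifs with h
    · subst h; simp
    · obtain ⟨i, hi⟩ := Function.ne_iff.1 h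
      exact Finset.prod_eq_zero (Finset.mem_univ i) (if_neg hi)
  have hΘint : ∀ α β : Fin n → Fin (d + 1), Integrable (fun u => Θ α u * ∏ i, u i ^ (β i : ℕ)) := by
    intro α β
    have hK : IsCompact (cube (0 : Rn n) 1) :=
      Metric.isCompact_of_isClosed_isBounded (isClosed_cube _ _)
        (Metric.isBounded_closedBall.subset fun x hx => by
          rw [Metric.mem_closedBall, dist_eq_norm]
          exact norm_sub_le_of_mem_cube zero_le_one hx)
    have hp : Continuous (fun u : Rn n => ∏ i, u i ^ (β i : ℕ)) := by fun_prop
    have h1 := (hp.continuousOn.integrableOn_compact hK (μ := volume)).bdd_mul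
      (hΘm α).aestronglyMeasurable
      (c := T ^ n) (Filter.Eventually.of_forall fun u => hΘb α u)
    refine (IntegrableOn.integrable_of_forall_notMem_eq_zero (s := cube (0 : Rn n) 1) h1 ?_)
    intro u hu
    rw [hΘs α u hu, zero_mul]
  refine ⟨T ^ n, by positivity, fun z ℓ hℓ mom => ?_⟩
  refine ⟨fun y => ∑ α, mom α * ((Θ α (ℓ⁻¹ • (y - z)) : ℝ) : ℂ), ?_, ?_, ?_, ?_⟩
  · refine Finset.measurable_sum _ fun α _ => Measurable.const_mul ?_ _
    exact Complex.measurable_ofReal.comp ((hΘm α).comp (by fun_prop))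
  · intro y
    refine (norm_sum_le _ _).trans ?_
    rw [Finset.mul_sum]
    refine Finset.sum_le_sum fun α _ => ?_
    rw [norm_mul, Complex.norm_real, mul_comm]
    gcongr
    exact hΘb α _
  · intro y hy
    refine Finset.sum_eq_zero fun α _ => ?_
    rw [hΘs, Complex.ofReal_zero, mul_zero]
    intro h
    refine hy fun i => ?_
    have h1 : |ℓ⁻¹ * (y i - z i) - 0| ≤ 1 / 2 := h i
    rw [sub_zero, abs_mul, abs_of_pos (inv_pos.2 hℓ), inv_mul_le_iff₀ hℓ] at h1
    linarith
  · intro β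
    have e : ∀ y, (∑ α, mom α * ((Θ α (ℓ⁻¹ • (y - z)) : ℝ) : ℂ)) *
        scaledMono z ℓ (fun i => β i) y =
        (fun u : Rn n => ∑ α, mom α * ((Θ α u * ∏ i, u i ^ (β i : ℕ) : ℝ) : ℂ))
          (ℓ⁻¹ • (y - z)) := by
      intro y
      simp only [scaledMono, Finset.sum_mul]
      refine Finset.sum_congr rfl fun α _ => ?_
      push_cast
      ring
    simp only [e]
    rw [integral_comp_dil (fun u : Rn n => ∑ α, mom α * ((Θ α u * ∏ i, u i ^ (β i : ℕ) : ℝ) : ℂ))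
      z hℓ]
    rw [integral_finsetSum _ fun α _ => ((hΘint α β).ofReal.const_mul _)]
    simp only [integral_const_mul, integral_complex_ofReal, hΘi]
    rw [Finset.sum_eq_single β]
    · simp
    · intro α _ hα; simp [hα]
    · simp

end Duals

/-! ### From scaled monomials to all polynomials -/

section Moments

variable {n : ℕ}

/-- If the moments in the coordinates `(y - z) / ℓ` vanish, so do the integrals against all
polynomials in these coordinates. -/
theorem integral_mul_eval_eq_zero {b : Rn n → ℂ} {z : Rn n} {ℓ : ℝ} {d : ℕ}
    (hint : ∀ p : Rn n → ℂ, Continuous p → Integrable (fun y => b y * p y))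
    (hb : ∀ β : Fin n → Fin (d + 1), ∫ y, b y * scaledMono z ℓ (fun i => β i) y = 0)
    (q : MvPolynomial (Fin n) ℂ) (hq : q.totalDegree ≤ d) :
    ∫ y, b y * MvPolynomial.eval (fun i => (((ℓ⁻¹ • (y - z)) i : ℝ) : ℂ)) q = 0 := by
  simp only [MvPolynomial.eval_eq', Finset.mul_sum]
  have hc : ∀ β, Continuous (scaledMono z ℓ β) := fun β => (contDiff_scaledMono z ℓ β).continuous
  have e : ∀ (y : Rn n) (m : Fin n →₀ ℕ), b y * (MvPolynomial.coeff m q *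
      ∏ i, (((ℓ⁻¹ • (y - z)) i : ℝ) : ℂ) ^ m i) =
      MvPolynomial.coeff m q * (b y * scaledMono z ℓ m y) := by
    intro y m; simp only [scaledMono]; ring
  simp only [e]
  have hi : ∀ m : Fin n →₀ ℕ, Integrable (fun y => b y * scaledMono z ℓ m y) := fun m =>
    hint _ (hc m)
  rw [integral_finsetSum _ fun m _ => (hi m).const_mul (MvPolynomial.coeff m q)]
  refine Finset.sum_eq_zero fun m hm => ?_
  rw [integral_const_mul]
  have hle : ∀ i, m i < d + 1 := by
    intro i
    have h1 := (MvPolynomial.le_totalDegree hm).trans hq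
    have h2 : m i ≤ m.sum fun _ e => e := by
      rw [Finsupp.sum_fintype _ _ (fun _ => rfl)]
      exact Finset.single_le_sum (fun _ _ => Nat.zero_le _) (Finset.mem_univ i)
    omega
  have := hb fun i => ⟨m i, hle i⟩
  simp only at this
  rw [this, mul_zero]

/-- Substituting y_i = z_i + ℓu_i turns a monomial in y into a polynomial in u of no larger degree.
-/
theorem integral_mul_monomial_eq_zero {b : Rn n → ℂ} {z : Rn n} {ℓ : ℝ} (hℓ : 0 < ℓ) {d : ℕ}
    (hint : ∀ p : Rn n → ℂ, Continuous p → Integrable (fun y => b y * p y))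
    (hb : ∀ β : Fin n → Fin (d + 1), ∫ y, b y * scaledMono z ℓ (fun i => β i) y = 0)
    (α : Fin n → ℕ) (hα : ∑ i, α i ≤ d) :
    ∫ y, b y * ((∏ i, y i ^ α i : ℝ) : ℂ) = 0 := by
  let q : MvPolynomial (Fin n) ℂ :=
    ∏ i, (MvPolynomial.C (z i : ℂ) + MvPolynomial.C (ℓ : ℂ) * MvPolynomial.X i) ^ α i
  have hq : q.totalDegree ≤ d := by
    refine (MvPolynomial.totalDegree_finsetProd _ _).trans (le_trans ?_ hα)
    refine Finset.sum_le_sum fun i _ => (MvPolynomial.totalDegree_pow _ _).trans ?_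
    have h1 : (MvPolynomial.C (z i : ℂ) +
        MvPolynomial.C (ℓ : ℂ) * MvPolynomial.X i).totalDegree ≤ 1 := by
      refine (MvPolynomial.totalDegree_add _ _).trans (max_le (by simp) ?_)
      refine (MvPolynomial.totalDegree_mul _ _).trans ?_
      simp
    nlinarith
  rw [← integral_mul_eval_eq_zero hint hb q hq]
  refine integral_congr_ae (Filter.Eventually.of_forall fun y => ?_)
  simp only [q, map_prod, map_pow, map_add, map_mul, MvPolynomial.eval_C, MvPolynomial.eval_X]
  congr 1
  push_cast
  refine Finset.prod_congr rfl fun i _ => ?_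
  congr 1
  have h1 : ((ℓ⁻¹ • (y - z)) i : ℝ) = ℓ⁻¹ * (y i - z i) := rfl
  rw [h1]
  push_cast
  have : (ℓ : ℂ) ≠ 0 := by exact_mod_cast hℓ.ne'
  field_simp
  ring

/-- Expanding y − z in the standard basis makes the diagonal a homogeneous polynomial of degree `m`
in the scaled coordinates. This is what removes the Taylor polynomial in the far estimate. -/
theorem integral_mul_diagonal_eq_zero {b : Rn n → ℂ} {z : Rn n} {ℓ : ℝ} (hℓ : 0 < ℓ) {d : ℕ}
    (hint : ∀ p : Rn n → ℂ, Continuous p → Integrable (fun y => b y * p y))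
    (hb : ∀ β : Fin n → Fin (d + 1), ∫ y, b y * scaledMono z ℓ (fun i => β i) y = 0)
    {m : ℕ} (hm : m ≤ d) (A : Rn n [×m]→L[ℝ] ℂ) :
    ∫ y, b y * A (fun _ => y - z) = 0 := by
  let e : Fin n → Rn n := fun i => EuclideanSpace.single i (1 : ℝ)
  let q : MvPolynomial (Fin n) ℂ := ∑ r : Fin m → Fin n,
    MvPolynomial.C (A fun j => e (r j)) *
      ∏ j, (MvPolynomial.C (ℓ : ℂ) * MvPolynomial.X (r j))
  have hq : q.totalDegree ≤ d := by
    refine MvPolynomial.totalDegree_finsetSum_le fun r _ => ?_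
    refine (MvPolynomial.totalDegree_mul _ _).trans ?_
    rw [MvPolynomial.totalDegree_C, zero_add]
    refine (MvPolynomial.totalDegree_finsetProd _ _).trans ?_
    calc _ ≤ ∑ _j : Fin m, 1 := Finset.sum_le_sum fun j _ =>
          (MvPolynomial.totalDegree_mul _ _).trans (by simp)
      _ = m := by simp
      _ ≤ d := hm
  rw [← integral_mul_eval_eq_zero hint hb q hq]
  refine integral_congr_ae (Filter.Eventually.of_forall fun y => ?_)
  simp only [q, map_sum, map_prod, map_mul, MvPolynomial.eval_C, MvPolynomial.eval_X]
  congr 1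
  have h0 : y - z = ∑ i, (y - z) i • e i := by
    ext j
    simp [e, Pi.single_apply]
  have h1 : A (fun _ => y - z) = A (fun _ => ∑ i, (y - z) i • e i) := by rw [← h0]
  rw [h1, A.map_sum]
  refine Finset.sum_congr rfl fun r _ => ?_
  rw [A.map_smul_univ (fun j => (y - z) (r j)) (fun j => e (r j)), mul_comm]
  rw [Complex.real_smul]
  congr 1
  push_cast
  refine Finset.prod_congr rfl fun j _ => ?_
  have h2 : ((ℓ⁻¹ • (y - z)) (r j) : ℝ) = ℓ⁻¹ * (y - z) (r j) := rfl
  rw [h2]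
  push_cast
  have : (ℓ : ℂ) ≠ 0 := by exact_mod_cast hℓ.ne'
  field_simp

end Moments

/-! ### Estimates for the bad parts -/

section BadParts

variable {n : ℕ}

theorem isCompact_cube (z : Rn n) {ℓ : ℝ} (hℓ : 0 ≤ ℓ) : IsCompact (cube z ℓ) :=
  Metric.isCompact_of_isClosed_isBounded (isClosed_cube _ _)
    (Metric.isBounded_closedBall.subset fun x hx => by
      rw [Metric.mem_closedBall, dist_eq_norm]
      exact norm_sub_le_of_mem_cube hℓ hx)

theorem integrable_mul_of_bounded_of_compact {Q p : Rn n → ℂ} (hQ : Measurable Q) {T : ℝ}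
    (hT : ∀ y, ‖Q y‖ ≤ T) {K : Set (Rn n)} (hK : IsCompact K) (h0 : ∀ y, y ∉ K → Q y = 0)
    (hp : Continuous p) : Integrable (fun y => Q y * p y) := by
  have h1 := (hp.continuousOn.integrableOn_compact hK (μ := volume)).bdd_mul
    hQ.aestronglyMeasurable (c := T) (Filter.Eventually.of_forall hT)
  refine IntegrableOn.integrable_of_forall_notMem_eq_zero (s := K) h1 ?_
  intro y hy
  rw [h0 y hy, zero_mul]

theorem integrable_mul_mul_of_tsupport {f η p : Rn n → ℂ} (hf : LocallyIntegrable f volume)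
    (hη : Continuous η) (hc : HasCompactSupport η) (hp : Continuous p) :
    Integrable (fun y => η y * p y * f y) := by
  have := hf.integrable_smul_left_of_hasCompactSupport (hη.mul hp) hc.mul_right
  simpa using this

/-- The bump estimate for a product of a cutoff at `z` of scale `ℓ` and a function with
derivative bounds near `z`. -/
theorem enorm_integral_cutoff_mul_le {N : ℕ} {F : 𝓢'(Rn n, ℂ)} {f : Rn n → ℂ}
    (hF : IsLocIntegrableRep F f) {η ζ : Rn n → ℂ} (hη : ContDiff ℝ ∞ η) (hζ : ContDiff ℝ ∞ ζ)
    {z x : Rn n} {ℓ a B B' : ℝ} (hℓ : 0 < ℓ) (hB : 0 < B) (hB' : 0 < B') (ha : 0 ≤ a)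
    (hs : tsupport η ⊆ Metric.closedBall z (2 * n * ℓ)) (hηb : ∀ y, ScaleBound N ℓ B η y)
    (hζb : ∀ y ∈ Metric.closedBall z (2 * n * ℓ), ScaleBound N ℓ B' ζ y)
    (hx : ‖x - z‖ ≤ a * ℓ) :
    ‖∫ y, η y * ζ y * f y‖ₑ ≤
      ENNReal.ofReal ((1 + 2 * n + a) ^ N * (2 ^ N * B * B') * ℓ ^ n) * grandMax N F x := by
  have hc : HasCompactSupport η := HasCompactSupport.of_support_subset_isCompact
    (isCompact_closedBall z (2 * n * ℓ)) (subset_closure.trans hs)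
  refine enorm_integral_mul_le hF (hη.mul hζ) hc.mul_right hℓ (by positivity) ?_
  intro m hm y
  by_cases hy : y ∈ Metric.closedBall z (2 * n * ℓ)
  · have h1 := ScaleBound.mul hℓ hη hζ (hηb y) (hζb y hy) m hm
    have h2 : 1 + ‖y - x‖ / ℓ ≤ 1 + 2 * n + a := by
      have h3 : ‖y - x‖ ≤ (2 * n + a) * ℓ := by
        rw [Metric.mem_closedBall, dist_eq_norm] at hy
        have : y - x = (y - z) - (x - z) := by abel
        rw [this]
        refine (norm_sub_le _ _).trans ?_
        linarith
      have := (div_le_iff₀ hℓ).2 h3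
      linarith
    rw [mul_assoc ((1 + 2 * (n : ℝ) + a) ^ N)]
    gcongr
  · have h1 : y ∉ tsupport (fun y => η y * ζ y) := fun h =>
      hy (hs (tsupport_mul_subset_left h))
    have h2 := ScaleBound.of_notMem_tsupport (N := N) hℓ (le_refl (0 : ℝ)) h1 m hm
    have h3 : ‖iteratedFDeriv ℝ m (fun y => η y * ζ y) y‖ = 0 :=
      le_antisymm (by simpa using h2) (norm_nonneg _)
    rw [h3, mul_zero]
    positivity

/-- Compactness gives a bound at z = 0, ℓ = 1 for the finitely many exponents and orders, and an
affine change of variables moves it to every z and ℓ. -/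
theorem exists_scaleBound_scaledMono (n N d : ℕ) : ∃ D : ℝ, 0 < D ∧
    ∀ (β : Fin n → Fin (d + 1)) (z : Rn n) (ℓ : ℝ), 0 < ℓ →
      ∀ y ∈ Metric.closedBall z (2 * n * ℓ),
        ScaleBound N ℓ D (scaledMono z ℓ (fun i => β i)) y := by
  have h : ∀ (β : Fin n → Fin (d + 1)) (m : Fin (N + 1)), ∃ D : ℝ,
      ∀ u ∈ Metric.closedBall (0 : Rn n) (2 * n),
        ‖iteratedFDeriv ℝ m (scaledMono (0 : Rn n) 1 (fun i => β i)) u‖ ≤ D := by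
    intro β m
    have hc : Continuous (iteratedFDeriv ℝ m (scaledMono (0 : Rn n) 1 (fun i => β i))) :=
      (contDiff_scaledMono _ _ _).continuous_iteratedFDeriv (natCast_le_smooth m)
    exact (isCompact_closedBall _ _).exists_bound_of_continuousOn hc.continuousOn
  choose D hD using h
  refine ⟨∑ β, ∑ m, |D β m| + 1, by positivity, fun β z ℓ hℓ y hy m hm => ?_⟩
  have e : scaledMono z ℓ (fun i => (β i : ℕ)) =
      fun y => scaledMono (0 : Rn n) 1 (fun i => β i) (-(ℓ⁻¹ • z) + ℓ⁻¹ • y) := by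
    ext y
    unfold scaledMono
    refine Finset.prod_congr rfl fun i _ => ?_
    have e0 : (1 : ℝ)⁻¹ • (-(ℓ⁻¹ • z) + ℓ⁻¹ • y - 0) = ℓ⁻¹ • (y - z) := by
      rw [inv_one, one_smul, sub_zero, smul_sub, sub_eq_neg_add]
    rw [e0]
  rw [e, norm_iteratedFDeriv_comp_affine (contDiff_scaledMono _ _ _), abs_of_pos (inv_pos.2 hℓ),
    mul_comm]
  have hinv := inv_pos.2 hℓ
  gcongr
  have hu : -(ℓ⁻¹ • z) + ℓ⁻¹ • y ∈ Metric.closedBall (0 : Rn n) (2 * n) := by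
    rw [Metric.mem_closedBall, dist_eq_norm] at hy ⊢
    rw [sub_zero, ← sub_eq_neg_add, ← smul_sub, norm_smul, norm_inv, Real.norm_of_nonneg hℓ.le,
      inv_mul_le_iff₀ hℓ]
    linarith
  have h1 := hD β ⟨m, by omega⟩ _ hu
  have h2 : |D β ⟨m, by omega⟩| ≤ ∑ m, |D β m| :=
    Finset.single_le_sum (f := fun m => |D β m|) (fun _ _ => abs_nonneg _) (Finset.mem_univ _)
  have h3 : ∑ m, |D β m| ≤ ∑ β, ∑ m, |D β m| :=
    Finset.single_le_sum (f := fun β => ∑ m, |D β m|)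
      (fun _ _ => Finset.sum_nonneg fun _ _ => abs_nonneg _) (Finset.mem_univ _)
  have h4 := le_abs_self (D β ⟨m, by omega⟩)
  exact h1.trans (by linarith)

/-- A bounded correction supported in a cube with the same moments as `η f`. -/
theorem exists_moment_correction (n N d : ℕ) {B : ℝ} (hB : 0 < B) : ∃ C : ℝ, 0 < C ∧
    ∀ (F : 𝓢'(Rn n, ℂ)) (f : Rn n → ℂ), IsLocIntegrableRep F f →
    ∀ (z x₀ : Rn n) (ℓ lam : ℝ) (η : Rn n → ℂ), 0 < ℓ → 0 < lam → ContDiff ℝ ∞ η →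
      tsupport η ⊆ Metric.closedBall z (2 * n * ℓ) → (∀ y, ScaleBound N ℓ B η y) →
      ‖x₀ - z‖ ≤ 40 * (n : ℝ) ^ 2 * ℓ → grandMax N F x₀ ≤ ENNReal.ofReal lam →
      ∃ Q : Rn n → ℂ, Measurable Q ∧ (∀ y, ‖Q y‖ ≤ C * lam) ∧ (∀ y, y ∉ cube z ℓ → Q y = 0) ∧
        ∀ β : Fin n → Fin (d + 1),
          ∫ y, (η y * f y - Q y) * scaledMono z ℓ (fun i => β i) y = 0 := by
  obtain ⟨T, hT, hcorr⟩ := exists_correction n d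
  obtain ⟨D, hD, hDb⟩ := exists_scaleBound_scaledMono n N d
  set K : ℝ := (1 + 2 * n + 40 * (n : ℝ) ^ 2) ^ N * (2 ^ N * B * D) with hK
  have hK0 : 0 < K := by positivity
  refine ⟨T * (((d + 1) ^ n : ℕ) * K), by positivity, ?_⟩
  intro F f hF z x₀ ℓ lam η hℓ hlam hη hs hηb hx₀ hM
  let mom : (Fin n → Fin (d + 1)) → ℂ := fun β =>
    ((ℓ : ℂ) ^ n)⁻¹ * ∫ y, η y * scaledMono z ℓ (fun i => β i) y * f y
  -- The cutoff times a scaled monomial is a bump of scale ℓ, and x₀ lies within a multiple of ℓ, so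
  -- the maximal function may be evaluated there, where it is at most λ.
  have hmom : ∀ β, ‖mom β‖ ≤ K * lam := by
    intro β
    have h1 := (enorm_integral_cutoff_mul_le hF hη (contDiff_scaledMono z ℓ (fun i => β i)) hℓ hB hD
      (by positivity) hs hηb (hDb β z ℓ hℓ) hx₀).trans (mul_le_mul_right hM _)
    rw [← ENNReal.ofReal_mul (by positivity), ← ofReal_norm,
      ENNReal.ofReal_le_ofReal_iff (by positivity)] at h1
    simp only [mom]
    rw [norm_mul, norm_inv, norm_pow, Complex.norm_real, Real.norm_of_nonneg hℓ.le,
      inv_mul_le_iff₀ (by positivity)]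
    linarith
  obtain ⟨Q, hQm, hQb, hQs, hQi⟩ := hcorr z ℓ hℓ mom
  have hQb' : ∀ y, ‖Q y‖ ≤ T * (((d + 1) ^ n : ℕ) * K) * lam := by
    intro y
    refine (hQb y).trans ?_
    rw [mul_assoc T]
    gcongr
    calc ∑ α, ‖mom α‖ ≤ ∑ _α : Fin n → Fin (d + 1), K * lam :=
          Finset.sum_le_sum fun α _ => hmom α
      _ = ((d + 1) ^ n : ℕ) * K * lam := by
        rw [Finset.sum_const, Finset.card_univ, Fintype.card_fun, Fintype.card_fin,
          Fintype.card_fin, nsmul_eq_mul]; ring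
  refine ⟨Q, hQm, hQb', hQs, fun β => ?_⟩
  have hc : HasCompactSupport η := HasCompactSupport.of_support_subset_isCompact
    (isCompact_closedBall z (2 * n * ℓ)) (subset_closure.trans hs)
  have hp := (contDiff_scaledMono z ℓ (fun i => (β i : ℕ))).continuous
  have e : ∀ y, (η y * f y - Q y) * scaledMono z ℓ (fun i => β i) y =
      η y * scaledMono z ℓ (fun i => β i) y * f y - Q y * scaledMono z ℓ (fun i => β i) y := by
    intro y; ring
  simp only [e]
  rw [integral_sub (integrable_mul_mul_of_tsupport hF.1 hη.continuous hc hp)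
    (integrable_mul_of_bounded_of_compact hQm hQb' (isCompact_cube z hℓ.le) hQs hp), hQi β]
  simp only [mom]
  have : (ℓ : ℂ) ^ n ≠ 0 := by exact_mod_cast (pow_pos hℓ n).ne'
  rw [mul_inv_cancel_left₀ this, sub_self]

theorem contDiff_dil (Φ : 𝓢(Rn n, ℂ)) (t : ℝ) (x : Rn n) :
    ContDiff ℝ ∞ (fun y => Φ (t⁻¹ • (x - y))) :=
  (Φ.smooth ⊤).comp (by fun_prop : ContDiff ℝ ∞ fun y : Rn n => t⁻¹ • (x - y))

theorem integral_norm_dilTrans (Φ : 𝓢(Rn n, ℂ)) (t : Ioi (0 : ℝ)) (x : Rn n) :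
    ∫ y, ‖dilTrans Φ t x y‖ = ∫ u, ‖Φ u‖ := by
  have ht : (0 : ℝ) < t := t.2
  have e : ∀ y, ‖dilTrans Φ t x y‖ = ((t : ℝ) ^ n)⁻¹ *
      (fun u => ‖Φ (-u)‖) ((t : ℝ)⁻¹ • (y - x)) := by
    intro y
    rw [dilTrans_apply, norm_mul, Complex.norm_real, Real.norm_of_nonneg (by positivity)]
    simp only
    rw [← smul_neg, neg_sub]
  simp only [e]
  rw [integral_const_mul]
  rw [integral_comp_dil (fun u => ‖Φ (-u)‖) x ht, smul_eq_mul,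
    inv_mul_cancel_left₀ (pow_pos ht n).ne']
  exact integral_neg_eq_self (fun u => ‖Φ u‖) volume

/-- The bad part near the cube. -/
theorem exists_enorm_near_le (n N : ℕ) {B C₁ : ℝ} (hB : 0 < B) (hC₁ : 0 < C₁)
    (Φ : 𝓢(Rn n, ℂ)) : ∃ C : ℝ, 0 < C ∧
    ∀ (F : 𝓢'(Rn n, ℂ)) (f : Rn n → ℂ), IsLocIntegrableRep F f →
    ∀ (z : Rn n) (ℓ lam : ℝ) (η Q : Rn n → ℂ), 0 < ℓ → 0 < lam → ContDiff ℝ ∞ η →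
      tsupport η ⊆ Metric.closedBall z (2 * n * ℓ) → (∀ y, ScaleBound N ℓ B η y) →
      Measurable Q → (∀ y, ‖Q y‖ ≤ C₁ * lam) → (∀ y, y ∉ cube z ℓ → Q y = 0) →
      ∀ x ∈ cube z (8 * n * ℓ), ENNReal.ofReal lam < grandMax N F x → ∀ t : Ioi (0 : ℝ),
        ‖∫ y, dilTrans Φ t x y * (η y * f y - Q y)‖ₑ ≤ ENNReal.ofReal C * grandMax N F x := by
  obtain ⟨S, hS0, hS⟩ := exists_schwartz_bound Φ N N
  set I : ℝ := ∫ u, ‖Φ u‖ with hI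
  have hI0 : 0 ≤ I := integral_nonneg fun _ => norm_nonneg _
  set K : ℝ := (1 + 2 * n + 4 * (n : ℝ) ^ 2) ^ N * (2 ^ N * B * S) with hKdef
  have hK0 : 0 < K := by positivity
  have hK1 : 2 ^ N * B * S ≤ K :=
    le_mul_of_one_le_left (by positivity) (one_le_pow₀ (by
      have : (0 : ℝ) ≤ n := Nat.cast_nonneg n
      nlinarith [sq_nonneg (n : ℝ)]))
  refine ⟨K + C₁ * I, by positivity, ?_⟩
  intro F f hF z ℓ lam η Q hℓ hlam hη hs hηb hQm hQb hQs x hx hMx t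
  have ht : (0 : ℝ) < t := t.2
  have hc : HasCompactSupport η := HasCompactSupport.of_support_subset_isCompact
    (isCompact_closedBall z (2 * n * ℓ)) (subset_closure.trans hs)
  set ζ : Rn n → ℂ := fun y => Φ ((t : ℝ)⁻¹ • (x - y)) with hζdef
  have hζ : ContDiff ℝ ∞ ζ := contDiff_dil Φ t x
  have hdc : Continuous (dilTrans Φ t x) := (dilTrans Φ t x).continuous
  have e : ∀ y, dilTrans Φ t x y * (η y * f y - Q y) =
      η y * dilTrans Φ t x y * f y - Q y * dilTrans Φ t x y := by intro y; ring
  simp only [e]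
  rw [integral_sub (integrable_mul_mul_of_tsupport hF.1 hη.continuous hc hdc)
    (integrable_mul_of_bounded_of_compact hQm hQb (isCompact_cube z hℓ.le) hQs hdc)]
  have h1 : ‖∫ y, η y * dilTrans Φ t x y * f y‖ₑ ≤ ENNReal.ofReal K * grandMax N F x := by
    have e1 : ∫ y, η y * dilTrans Φ t x y * f y =
        ((((t : ℝ) ^ n)⁻¹ : ℝ) : ℂ) * ∫ y, η y * ζ y * f y := by
      rw [← integral_const_mul]
      refine integral_congr_ae (Filter.Eventually.of_forall fun y => ?_)
      simp only [dilTrans_apply, hζdef]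
      ring
    rw [e1, enorm_mul]
    have e2 : ‖((((t : ℝ) ^ n)⁻¹ : ℝ) : ℂ)‖ₑ = ENNReal.ofReal (((t : ℝ) ^ n)⁻¹) := by
      rw [← ofReal_norm, Complex.norm_real, Real.norm_of_nonneg (by positivity)]
    rw [e2]
    -- For t ≥ ℓ the kernel is smooth at scale ℓ and the product is a bump of scale ℓ. For t < ℓ the
    -- cutoff is smooth at scale t and the product is a bump of scale t centred at x, with the decay
    -- inherited from Φ.
    rcases le_or_gt ℓ (t : ℝ) with htl | htl
    · have hζb : ∀ y ∈ Metric.closedBall z (2 * n * ℓ), ScaleBound N ℓ S ζ y := by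
        intro y _ m hm
        rw [norm_iteratedFDeriv_dil (Φ.smooth ⊤) x ht, mul_comm]
        have h2 := hS m hm ((t : ℝ)⁻¹ • (x - y))
        have h3 : ‖iteratedFDeriv ℝ m Φ ((t : ℝ)⁻¹ • (x - y))‖ ≤ S := by
          refine le_trans (le_mul_of_one_le_left (norm_nonneg _) (one_le_pow₀ ?_)) h2
          linarith [norm_nonneg ((t : ℝ)⁻¹ • (x - y))]
        have h4 : (t : ℝ)⁻¹ ≤ ℓ⁻¹ := inv_anti₀ hℓ htl
        gcongr
      have hxz : ‖x - z‖ ≤ 4 * (n : ℝ) ^ 2 * ℓ := by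
        refine (norm_sub_le_of_mem_cube (by positivity) hx).trans ?_
        linarith
      refine (mul_le_mul_right (enorm_integral_cutoff_mul_le hF hη hζ hℓ hB hS0 (by positivity)
        hs hηb hζb hxz) _).trans ?_
      rw [← mul_assoc, ← ENNReal.ofReal_mul (by positivity), ← hKdef]
      refine mul_le_mul_left (ENNReal.ofReal_le_ofReal ?_) _
      have h5 : ℓ ^ n ≤ (t : ℝ) ^ n := pow_le_pow_left₀ hℓ.le htl n
      rw [inv_mul_le_iff₀ (by positivity), mul_comm]
      gcongr
    · have h2 : ∀ m ≤ N, ∀ y, (1 + ‖y - x‖ / t) ^ N *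
          ‖iteratedFDeriv ℝ m (fun y => η y * ζ y) y‖ ≤ (2 ^ N * B * S) * (t : ℝ)⁻¹ ^ m := by
        intro m hm y
        set w : ℝ := (1 + ‖y - x‖ / t) ^ N with hw
        have hw0 : 0 < w := by positivity
        have hζb : ScaleBound N t (S / w) ζ y := by
          intro j hj
          rw [norm_iteratedFDeriv_dil (Φ.smooth ⊤) x ht, mul_comm]
          gcongr
          rw [le_div_iff₀ hw0, mul_comm]
          have h3 := hS j hj ((t : ℝ)⁻¹ • (x - y))
          rw [norm_smul, norm_inv, Real.norm_of_nonneg ht.le, inv_mul_eq_div,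
            norm_sub_rev] at h3
          exact h3
        have h4 := ScaleBound.mul ht hη hζ ((hηb y).mono ht htl.le le_rfl) hζb m hm
        calc _ ≤ w * (2 ^ N * B * (S / w) * (t : ℝ)⁻¹ ^ m) := by gcongr
          _ = _ := by field_simp
      refine (mul_le_mul_right (enorm_integral_mul_le hF (hη.mul hζ) hc.mul_right ht
        (by positivity) h2) _).trans ?_
      rw [← mul_assoc, ← ENNReal.ofReal_mul (by positivity)]
      refine mul_le_mul_left (ENNReal.ofReal_le_ofReal ?_) _
      rw [inv_mul_le_iff₀ (by positivity), mul_comm]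
      gcongr
  -- The correction has size λ, the dilates of Φ share one L¹ norm, and λ is below the maximal
  -- function at x.
  have h2 : ‖∫ y, Q y * dilTrans Φ t x y‖ₑ ≤ ENNReal.ofReal (C₁ * I) * grandMax N F x := by
    have h3 : ‖∫ y, Q y * dilTrans Φ t x y‖ ≤ C₁ * lam * I := by
      have h4 := norm_integral_le_of_norm_le (f := fun y => Q y * dilTrans Φ t x y)
        (g := fun y => C₁ * lam * ‖dilTrans Φ t x y‖)
        (((dilTrans Φ t x).integrable (μ := volume)).norm.const_mul _)
        (Filter.Eventually.of_forall fun y => by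
          rw [norm_mul]; exact mul_le_mul_of_nonneg_right (hQb y) (norm_nonneg _))
      rw [integral_const_mul, integral_norm_dilTrans] at h4
      exact h4
    rw [← ofReal_norm]
    refine (ENNReal.ofReal_le_ofReal h3).trans ?_
    have e3 : C₁ * lam * I = C₁ * I * lam := by ring
    rw [e3, ENNReal.ofReal_mul (by positivity)]
    exact mul_le_mul_right hMx.le _
  refine (enorm_sub_le).trans ((add_le_add h1 h2).trans ?_)
  rw [← add_mul, ← ENNReal.ofReal_add hK0.le (by positivity)]

/-- The bad part away from the cube. -/
theorem exists_enorm_far_le (hn : 1 ≤ n) {N d : ℕ} (hd : d < N) {B C₁ : ℝ} (hB : 0 < B)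
    (hC₁ : 0 < C₁) (Φ : 𝓢(Rn n, ℂ)) : ∃ C : ℝ, 0 < C ∧
    ∀ (F : 𝓢'(Rn n, ℂ)) (f : Rn n → ℂ), IsLocIntegrableRep F f →
    ∀ (z x₀ : Rn n) (ℓ lam : ℝ) (η Q : Rn n → ℂ), 0 < ℓ → 0 < lam → ContDiff ℝ ∞ η →
      tsupport η ⊆ Metric.closedBall z (2 * n * ℓ) → (∀ y, ScaleBound N ℓ B η y) →
      ‖x₀ - z‖ ≤ 40 * (n : ℝ) ^ 2 * ℓ → grandMax N F x₀ ≤ ENNReal.ofReal lam →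
      Measurable Q → (∀ y, ‖Q y‖ ≤ C₁ * lam) → (∀ y, y ∉ cube z ℓ → Q y = 0) →
      (∀ β : Fin n → Fin (d + 1),
        ∫ y, (η y * f y - Q y) * scaledMono z ℓ (fun i => β i) y = 0) →
      ∀ x, x ∉ cube z (8 * n * ℓ) → ∀ t : Ioi (0 : ℝ),
        ‖∫ y, dilTrans Φ t x y * (η y * f y - Q y)‖ₑ ≤
          ENNReal.ofReal (C * lam * (ℓ / ‖x - z‖) ^ (n + d + 1)) := by
  have hn1 : (1 : ℝ) ≤ n := by exact_mod_cast hn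
  -- Decay of order n + m for the derivative of order m ≤ N cancels the factor t^(−n−m) produced by
  -- the dilation, so `hhb` is uniform in t.
  obtain ⟨S, hS0, hS⟩ := exists_schwartz_bound Φ (n + N) N
  set K : ℝ := (1 + 2 * n + 40 * (n : ℝ) ^ 2) ^ N * (2 ^ N * B) + C₁ with hKdef
  have hK0 : 0 < K := by positivity
  refine ⟨K * (S * 2 ^ (n + d + 1) * (2 * n) ^ (d + 1)), by positivity, ?_⟩
  intro F f hF z x₀ ℓ lam η Q hℓ hlam hη hs hηb hx₀ hM hQm hQb hQs hmom x hx t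
  have ht : (0 : ℝ) < t := t.2
  have hc : HasCompactSupport η := HasCompactSupport.of_support_subset_isCompact
    (isCompact_closedBall z (2 * n * ℓ)) (subset_closure.trans hs)
  set ρ : ℝ := ‖x - z‖ with hρ
  have hρ4 : 4 * n * ℓ < ρ := by
    by_contra h
    refine hx (closedBall_subset_cube z (r := 4 * n * ℓ) (by linarith) ?_)
    rw [Metric.mem_closedBall, dist_eq_norm]
    exact not_lt.1 h
  have hr0 : 0 < 2 * n * ℓ := by positivity
  have hρ0 : 0 < ρ := by linarith
  set h : Rn n → ℂ := ⇑(dilTrans Φ t x) with hh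
  have hhs : ContDiff ℝ ∞ h := (dilTrans Φ t x).smooth ⊤
  have hhb : ∀ m ≤ N, ∀ y ∈ Metric.closedBall z (2 * n * ℓ),
      ‖iteratedFDeriv ℝ m h y‖ ≤ S * (2 / ρ) ^ (n + m) := by
    intro m hm y hy
    rw [Metric.mem_closedBall, dist_eq_norm] at hy
    have hxy : ρ / 2 ≤ ‖x - y‖ := by
      have e : x - z = (x - y) + (y - z) := by abel
      have := norm_add_le (x - y) (y - z)
      rw [← e] at this
      linarith
    have e1 : h = ((((t : ℝ) ^ n)⁻¹ : ℝ) : ℂ) • fun y => Φ ((t : ℝ)⁻¹ • (x - y)) := by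
      ext y
      simp only [hh, dilTrans_apply, Pi.smul_apply, smul_eq_mul]
    rw [e1, iteratedFDeriv_const_smul_apply
      (((contDiff_dil Φ t x).of_le (natCast_le_smooth m)).contDiffAt), norm_smul,
      Complex.norm_real, Real.norm_of_nonneg (by positivity),
      norm_iteratedFDeriv_dil (Φ.smooth ⊤) x ht]
    have h1 := hS m hm ((t : ℝ)⁻¹ • (x - y))
    rw [norm_smul, norm_inv, Real.norm_of_nonneg ht.le] at h1
    set D : ℝ := ‖iteratedFDeriv ℝ m Φ ((t : ℝ)⁻¹ • (x - y))‖
    have hD0 : 0 ≤ D := norm_nonneg _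
    have h2 : ((t : ℝ)⁻¹ * (ρ / 2)) ^ (n + m) * D ≤ S := by
      refine le_trans ?_ h1
      refine mul_le_mul_of_nonneg_right ?_ hD0
      have ht' := inv_pos.2 ht
      calc ((t : ℝ)⁻¹ * (ρ / 2)) ^ (n + m) ≤ (1 + (t : ℝ)⁻¹ * ‖x - y‖) ^ (n + m) := by
            gcongr
            nlinarith [mul_le_mul_of_nonneg_left hxy ht'.le]
        _ ≤ (1 + (t : ℝ)⁻¹ * ‖x - y‖) ^ (n + N) := by
            refine pow_le_pow_right₀ ?_ (by omega)
            have : 0 ≤ (t : ℝ)⁻¹ * ‖x - y‖ := by positivity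
            linarith
    calc ((t : ℝ) ^ n)⁻¹ * ((t : ℝ)⁻¹ ^ m * D)
        = (2 / ρ) ^ (n + m) * (((t : ℝ)⁻¹ * (ρ / 2)) ^ (n + m) * D) := by
          rw [mul_pow, div_pow, div_pow, ← inv_pow, pow_add (t : ℝ)⁻¹]
          field_simp
      _ ≤ (2 / ρ) ^ (n + m) * S := by gcongr
      _ = _ := mul_comm _ _
  obtain ⟨A, hA1, hA2⟩ := exists_taylor hhs z d
  set R : Rn n → ℂ := fun y => h y - ∑ k ∈ Finset.range (d + 1), A k (fun _ => y - z) with hR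
  have hRs : ContDiff ℝ ∞ R := hhs.sub (ContDiff.sum fun k _ => contDiff_diagonal (A k) z)
  -- The size of the Taylor remainder at scale r = 2nℓ: its derivatives of order above `d` are those
  -- of the kernel, and each further order costs 2/ρ ≤ 1/r because ρ > 4nℓ.
  set BR : ℝ := S * (2 / ρ) ^ (n + d + 1) * (2 * n * ℓ) ^ (d + 1) with hBR
  have hBR0 : 0 < BR := by positivity
  have hRb := norm_iteratedFDeriv_le_of_vanish (N := N) (B := BR) hRs hr0 hd hA1
    (fun m hm hmN y hy => by
      rw [hA2 m hm y]
      refine (hhb m hmN y hy).trans ?_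
      obtain ⟨j, rfl⟩ : ∃ j, m = d + 1 + j := ⟨m - (d + 1), by omega⟩
      have h1 : (2 / ρ) ^ j ≤ ((2 * n * ℓ)⁻¹) ^ j := by
        refine pow_le_pow_left₀ (by positivity) ?_ j
        rw [div_le_iff₀ hρ0, inv_mul_eq_div, le_div_iff₀ hr0]
        linarith
      have e2 : S * (2 / ρ) ^ (n + (d + 1 + j)) = S * (2 / ρ) ^ (n + d + 1) * (2 / ρ) ^ j := by
        rw [← add_assoc, ← add_assoc, pow_add]; ring
      have e3 : BR * ((2 * n * ℓ)⁻¹) ^ (d + 1 + j) =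
          S * (2 / ρ) ^ (n + d + 1) * ((2 * n * ℓ)⁻¹) ^ j := by
        rw [hBR, pow_add (2 * n * ℓ)⁻¹, inv_pow _ (d + 1)]
        have := (pow_pos hr0 (d + 1)).ne'
        field_simp
      rw [e2, e3]
      gcongr)
  have hRsc : ∀ y ∈ Metric.closedBall z (2 * n * ℓ), ScaleBound N ℓ BR R y := by
    intro y hy
    have h1 : ScaleBound N (2 * n * ℓ) BR R y := fun m hm => hRb m hm y hy
    exact h1.mono hℓ (by nlinarith) le_rfl
  have hint : ∀ p : Rn n → ℂ, Continuous p →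
      Integrable (fun y => (η y * f y - Q y) * p y) := by
    intro p hp
    have := (integrable_mul_mul_of_tsupport hF.1 hη.continuous hc hp).sub
      (integrable_mul_of_bounded_of_compact hQm hQb (isCompact_cube z hℓ.le) hQs hp)
    refine this.congr (Filter.Eventually.of_forall fun y => ?_)
    simp only [Pi.sub_apply]
    ring
  have e1 : ∫ y, h y * (η y * f y - Q y) = ∫ y, (η y * f y - Q y) * R y := by
    have h1 : ∀ k : ℕ, Integrable (fun y => (η y * f y - Q y) * A k (fun _ => y - z)) :=
      fun k => hint _ (contDiff_diagonal (A k) z).continuous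
    have h2 : ∀ y, (η y * f y - Q y) * R y = h y * (η y * f y - Q y) -
        ∑ k ∈ Finset.range (d + 1), (η y * f y - Q y) * A k (fun _ => y - z) := by
      intro y
      rw [hR, ← Finset.mul_sum]
      ring
    simp only [h2]
    rw [integral_sub _ (integrable_finsetSum _ fun k _ => h1 k),
      integral_finsetSum _ fun k _ => h1 k, Finset.sum_eq_zero, sub_zero]
    · intro k hk
      exact integral_mul_diagonal_eq_zero hℓ hint hmom
        (Nat.lt_succ_iff.1 (Finset.mem_range.1 hk)) (A k)
    · exact (hint h hhs.continuous).congr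
        (Filter.Eventually.of_forall fun y => mul_comm _ _)
  rw [e1]
  have e2 : ∀ y, (η y * f y - Q y) * R y = η y * R y * f y - Q y * R y := by intro y; ring
  simp only [e2]
  rw [integral_sub (integrable_mul_mul_of_tsupport hF.1 hη.continuous hc hRs.continuous)
    (integrable_mul_of_bounded_of_compact hQm hQb (isCompact_cube z hℓ.le) hQs hRs.continuous)]
  -- Tested at x₀, not at x: this is where λ enters.
  have h1 := (enorm_integral_cutoff_mul_le hF hη hRs hℓ hB hBR0 (by positivity) hs hηb hRsc
    hx₀).trans (mul_le_mul_right hM _)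
  rw [← ENNReal.ofReal_mul (by positivity)] at h1
  have h2 : ‖∫ y, Q y * R y‖ ≤ C₁ * lam * BR * ℓ ^ n := by
    have e3 : ∫ y, Q y * R y = ∫ y in cube z ℓ, Q y * R y := by
      refine (setIntegral_eq_integral_of_forall_compl_eq_zero fun y hy => ?_).symm
      rw [hQs y hy, zero_mul]
    have hv : volume (cube z ℓ) < ⊤ := by
      rw [volume_cube]; exact ENNReal.pow_lt_top ENNReal.ofReal_lt_top
    rw [e3]
    refine (norm_setIntegral_le_of_norm_le_const hv (C := C₁ * lam * BR) fun y hy => ?_).trans ?_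
    · rw [norm_mul]
      have hy' : y ∈ Metric.closedBall z (2 * n * ℓ) := by
        rw [Metric.mem_closedBall, dist_eq_norm]
        refine (norm_sub_le_of_mem_cube hℓ.le hy).trans ?_
        nlinarith
      exact mul_le_mul (hQb y) (hRsc y hy').norm_le (norm_nonneg _) (by positivity)
    · rw [Measure.real, volume_cube, ENNReal.toReal_pow, ENNReal.toReal_ofReal hℓ.le]
  refine enorm_sub_le.trans ?_
  rw [← ofReal_norm (∫ y, Q y * R y)]
  refine (add_le_add h1 (ENNReal.ofReal_le_ofReal h2)).trans ?_
  rw [← ENNReal.ofReal_add (by positivity) (by positivity)]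
  refine ENNReal.ofReal_le_ofReal (le_of_eq ?_)
  rw [hKdef, hBR, div_pow, div_pow, mul_pow _ ℓ]
  field_simp
  ring

end BadParts

/-! ### The variable exponent norm -/

section VariableNorm

variable {n : ℕ}

theorem IsExponent.exists_ae_le {p : Rn n → ℝ} (hp : IsExponent p) : ∃ P : ℝ, ∀ᵐ x, p x ≤ P := by
  refine ⟨(essSup (fun x => ENNReal.ofReal (p x)) volume).toReal, ?_⟩
  filter_upwards [ENNReal.ae_le_essSup (fun x => ENNReal.ofReal (p x))] with x hx
  rw [← ENNReal.toReal_ofReal (hp.pos x).le]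
  exact ENNReal.toReal_mono hp.essSup_lt_top.ne hx

theorem IsMP0.ae_lt {p : Rn n → ℝ} {p₀ : ℝ} (hp : IsMP0 p p₀) : ∀ᵐ x, p₀ < p x := by
  filter_upwards [ae_essInf_le (f := fun x => ENNReal.ofReal (p x)) (μ := volume)] with x hx
  exact (ENNReal.ofReal_lt_ofReal_iff (hp.pos x)).1 (hp.p0_lt.trans_le hx)

theorem modular_mono {p : Rn n → ℝ} (hp : ∀ x, 0 ≤ p x) {f g : Rn n → ℝ≥0∞}
    (h : ∀ x, f x ≤ g x) : modular p f ≤ modular p g :=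
  lintegral_mono fun x => ENNReal.rpow_le_rpow (h x) (hp x)

theorem varNorm_le_of_modular {p : Rn n → ℝ} {f : Rn n → ℝ≥0∞} {μ : ℝ≥0} (hμ : 0 < μ)
    (h : modular p (fun x => f x / μ) ≤ 1) : varNorm p f ≤ μ :=
  iInf_le_of_le μ (iInf_le_of_le hμ (iInf_le _ h))

theorem modular_le_one_of_varNorm_lt {p : Rn n → ℝ} (hp : ∀ x, 0 ≤ p x) {f : Rn n → ℝ≥0∞}
    {μ : ℝ≥0} (h : varNorm p f < μ) : modular p (fun x => f x / μ) ≤ 1 := by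
  simp only [varNorm, iInf_lt_iff] at h
  obtain ⟨ν, hν, hm, hνμ⟩ := h
  refine (modular_mono hp fun x => ?_).trans hm
  exact ENNReal.div_le_div_left hνμ.le _

/-- A bound for every admissible μ passes to the infimum, so it need not be attained. -/
theorem le_mul_varNorm {p : Rn n → ℝ} {f : Rn n → ℝ≥0∞} {X : ℝ≥0∞} {K : ℝ≥0} (hK : 0 < K)
    (h : ∀ μ : ℝ≥0, 0 < μ → modular p (fun x => f x / μ) ≤ 1 → X ≤ K * μ) :
    X ≤ K * varNorm p f := by
  have hK' : (K : ℝ≥0∞) ≠ 0 := by exact_mod_cast hK.ne'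
  rw [mul_comm, ← ENNReal.div_le_iff hK' ENNReal.coe_ne_top]
  refine le_iInf fun μ => le_iInf fun hμ => le_iInf fun hm => ?_
  rw [ENNReal.div_le_iff hK' ENNReal.coe_ne_top, mul_comm]
  exact h μ hμ hm

/-- The superlevel sets of a function of finite norm have finite measure. -/
theorem volume_lt_top_of_varNorm_lt_top {p : Rn n → ℝ} (hp : IsExponent p) {g : Rn n → ℝ≥0∞}
    (hg : varNorm p g < ⊤) {lam : ℝ} (hlam : 0 < lam)
    (hm : MeasurableSet {x | ENNReal.ofReal lam < g x}) :
    volume {x | ENNReal.ofReal lam < g x} < ⊤ := by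
  obtain ⟨P, hP⟩ := hp.exists_ae_le
  simp only [varNorm, iInf_lt_iff] at hg
  obtain ⟨μ, hμ, hmod, -⟩ := hg
  have hμ' : (μ : ℝ≥0∞) ≠ 0 := by exact_mod_cast hμ.ne'
  set Ω := {x | ENNReal.ofReal lam < g x} with hΩ
  set κ : ℝ≥0∞ := ENNReal.ofReal lam / μ with hκ
  have hκ0 : κ ≠ 0 := ENNReal.div_ne_zero.2 ⟨(ENNReal.ofReal_pos.2 hlam).ne', ENNReal.coe_ne_top⟩
  have hκt : κ ≠ ⊤ := ENNReal.div_ne_top ENNReal.ofReal_ne_top hμ'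
  -- A lower bound for κ^p(x), whether κ ≥ 1 or κ ≤ 1, since 0 < p(x) ≤ P almost everywhere.
  set c : ℝ≥0∞ := min 1 (κ ^ P) with hc
  have hc0 : c ≠ 0 := by
    refine (lt_min one_pos ?_).ne'
    exact ENNReal.rpow_pos (pos_iff_ne_zero.2 hκ0) hκt
  have h1 : c * volume Ω ≤ 1 := by
    rw [← setLIntegral_const]
    refine le_trans ?_ ((setLIntegral_le_lintegral Ω _).trans hmod)
    refine setLIntegral_mono_ae' hm ?_
    filter_upwards [hP] with x hx hxΩ
    have h2 : κ ≤ g x / μ := ENNReal.div_le_div_right (le_of_lt hxΩ) _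
    refine le_trans ?_ (ENNReal.rpow_le_rpow h2 (hp.pos x).le)
    rcases le_total 1 κ with h3 | h3
    · refine (min_le_left _ _).trans ?_
      exact ENNReal.one_le_rpow h3 (hp.pos x)
    · refine (min_le_right _ _).trans ?_
      exact ENNReal.rpow_le_rpow_of_exponent_ge h3 hx
  by_contra h
  rw [not_lt, top_le_iff] at h
  rw [h, ENNReal.mul_top hc0] at h1
  exact absurd h1 (by simp)

/-- The concentric cube of side 2ρ contains both x and the given cube; the average over it is
(4nℓ/ρ)ⁿ. -/
theorem le_hlMax_indicator_cube (hn : 1 ≤ n) {z x : Rn n} {ℓ : ℝ} (hℓ : 0 < ℓ)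
    (hx : x ∉ cube z (8 * n * ℓ)) :
    ENNReal.ofReal ((ℓ / ‖x - z‖) ^ n) ≤
      hlMax (fun y => ‖(cube z (8 * n * ℓ)).indicator (fun _ => (1 : ℝ)) y‖ₑ) x := by
  have hn1 : (1 : ℝ) ≤ n := by exact_mod_cast hn
  set ρ : ℝ := ‖x - z‖ with hρ
  have hρ4 : 4 * n * ℓ < ρ := by
    by_contra h
    refine hx (closedBall_subset_cube z (r := 4 * n * ℓ) (by linarith) ?_)
    rw [Metric.mem_closedBall, dist_eq_norm]
    exact not_lt.1 h
  have hρ0 : 0 < ρ := lt_trans (by positivity) hρ4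
  have hmem : x ∈ cube z (2 * ρ) := by
    refine closedBall_subset_cube z le_rfl ?_
    rw [Metric.mem_closedBall, dist_eq_norm]
  have hsub : cube z (8 * n * ℓ) ⊆ cube z (2 * ρ) := fun y hy i => (hy i).trans (by linarith)
  refine le_trans ?_ (le_iSup_of_le z (le_iSup_of_le (2 * ρ)
    (le_iSup_of_le (by linarith : (0 : ℝ) < 2 * ρ) (le_iSup_of_le hmem le_rfl))))
  have h1 : ∫⁻ y in cube z (2 * ρ), ‖(cube z (8 * n * ℓ)).indicator (fun _ => (1 : ℝ)) y‖ₑ =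
      volume (cube z (8 * n * ℓ)) := by
    have e : ∀ y, ‖(cube z (8 * n * ℓ)).indicator (fun _ => (1 : ℝ)) y‖ₑ =
        (cube z (8 * n * ℓ)).indicator (fun _ => (1 : ℝ≥0∞)) y := by
      intro y
      by_cases hy : y ∈ cube z (8 * n * ℓ)
      · simp [hy]
      · simp [hy]
    simp only [e]
    rw [lintegral_indicator (measurableSet_cube _ _), setLIntegral_one,
      Measure.restrict_apply (measurableSet_cube _ _), inter_eq_left.2 hsub]
  rw [h1, volume_cube, volume_cube, ← ENNReal.ofReal_pow (by positivity),
    ← ENNReal.ofReal_pow (by positivity), ← ENNReal.ofReal_inv_of_pos (by positivity),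
    ← ENNReal.ofReal_mul (by positivity)]
  refine ENNReal.ofReal_le_ofReal ?_
  rw [← inv_pow, ← mul_pow]
  refine pow_le_pow_left₀ (by positivity) ?_ n
  rw [inv_mul_eq_div, div_le_div_iff₀ hρ0 (by positivity)]
  nlinarith [mul_pos hℓ hρ0]

/-- The norm of a function that is controlled by `u` on a cube and decays away from it. -/
theorem exists_varNorm_le (hn : 1 ≤ n) {p : Rn n → ℝ} {p₀ : ℝ} (hp : IsMP0 p p₀) {d : ℕ}
    (hd : (n : ℝ) / p₀ ≤ n + d + 1) {K : ℝ} (hK : 0 < K) : ∃ C : ℝ≥0,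
    ∀ (z : Rn n) (ℓ lam : ℝ) (u v : Rn n → ℝ≥0∞), 0 < ℓ → 0 < lam → Measurable u →
      (∀ x ∈ cube z (8 * n * ℓ), ENNReal.ofReal lam ≤ u x) →
      (∀ x ∈ cube z (8 * n * ℓ), v x ≤ ENNReal.ofReal K * u x) →
      (∀ x, x ∉ cube z (8 * n * ℓ) →
        v x ≤ ENNReal.ofReal (K * lam * (ℓ / ‖x - z‖) ^ (n + d + 1))) →
      varNorm p v ≤ C * varNorm p ((cube z (8 * n * ℓ)).indicator u) := by
  have hn1 : (1 : ℝ) ≤ n := by exact_mod_cast hn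
  have hp₀ := hp.p0_pos
  obtain ⟨C₀, hC₀⟩ := hp.maximal_bounded
  -- The summand 1 makes the later comparison with `ν` strict and ensures `C₃ ≥ 1`.
  set C₃ : ℝ≥0 := (C₀ + 1) ^ (1 / p₀) with hC₃
  -- Since p > p₀ almost everywhere, dividing by `E` halves the integrand of the modular at least.
  -- So the near and far parts can be added without a triangle inequality, which may fail when p <
  -- 1.
  set E : ℝ≥0 := 2 ^ (1 / p₀) with hE
  have hC₃1 : 1 ≤ C₃ := NNReal.one_le_rpow (by simp) (by positivity)
  have hE0 : 0 < E := NNReal.rpow_pos two_pos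
  set K' : ℝ≥0 := K.toNNReal with hK'
  have hK'0 : 0 < K' := Real.toNNReal_pos.2 hK
  refine ⟨K' * E * C₃, ?_⟩
  intro z ℓ lam u v hℓ hlam hum hu hv1 hv2
  set S := cube z (8 * n * ℓ) with hS
  have hC₃0 : 0 < C₃ := one_pos.trans_le hC₃1
  refine le_mul_varNorm (by positivity) fun μ hμ hmod => ?_
  set L : ℝ≥0 := lam.toNNReal with hL
  have hL0 : 0 < L := Real.toNNReal_pos.2 hlam
  have hLe : ENNReal.ofReal lam = L := rfl
  set χ : Rn n → ℝ := S.indicator (fun _ => (1 : ℝ)) with hχ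
  set W : Rn n → ℝ≥0∞ := hlMax (fun y => ‖χ y‖ₑ) with hW
  have hq : ∀ x, 0 ≤ p x / p₀ := fun x => div_nonneg (hp.pos x).le hp₀.le
  have hχint : LocallyIntegrable χ volume := by
    refine Integrable.locallyIntegrable ?_
    refine (integrable_indicator_iff (measurableSet_cube _ _)).2 ?_
    refine integrableOn_const ?_ ENNReal.coe_ne_top
    rw [volume_cube]
    exact (ENNReal.pow_lt_top ENNReal.ofReal_lt_top).ne
  set α : ℝ≥0 := (μ / L) ^ p₀ with hα
  have hα0 : 0 < α := NNReal.rpow_pos (div_pos hμ hL0)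
  -- From λχ ≤ u on the cube: the modular of χ/α with exponent p/p₀ is the modular of λχ/μ with
  -- exponent p.
  have hχn : varNorm (fun x => p x / p₀) (fun x => ‖χ x‖ₑ) ≤ α := by
    refine varNorm_le_of_modular hα0 (le_trans ?_ hmod)
    refine lintegral_mono fun x => ?_
    by_cases hx : x ∈ S
    · have e1 : ‖χ x‖ₑ / (α : ℝ≥0∞) = ((L / μ : ℝ≥0) : ℝ≥0∞) ^ p₀ := by
        have : χ x = 1 := indicator_of_mem hx _
        rw [this, hα, enorm_one, one_div, ← ENNReal.coe_inv (NNReal.rpow_pos (div_pos hμ hL0)).ne',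
          ← NNReal.inv_rpow, inv_div, ENNReal.coe_rpow_of_nonneg _ hp₀.le]
      simp only [e1]
      rw [← ENNReal.rpow_mul, mul_div_cancel₀ _ hp₀.ne', indicator_of_mem hx]
      refine ENNReal.rpow_le_rpow ?_ (hp.pos x).le
      rw [ENNReal.coe_div hμ.ne', ← hLe]
      exact ENNReal.div_le_div_right (hu x hx) _
    · have : χ x = 0 := indicator_of_notMem hx _
      simp only [this]
      rw [enorm_zero, ENNReal.zero_div, ENNReal.zero_rpow_of_pos (div_pos (hp.pos x) hp₀)]
      exact zero_le
  set ν : ℝ≥0 := (C₀ + 1) * α with hν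
  have hWn : modular (fun x => p x / p₀) (fun x => W x / ν) ≤ 1 := by
    refine modular_le_one_of_varNorm_lt hq (lt_of_le_of_lt ((hC₀ χ hχint).trans
      (mul_le_mul_right hχn _)) ?_)
    rw [hν]
    exact_mod_cast (by nlinarith [hα0] : C₀ * α < (C₀ + 1) * α)
  have hνp : ν ^ (1 / p₀) = C₃ * (μ / L) := by
    rw [hν, NNReal.mul_rpow, hα, ← NNReal.rpow_mul, mul_one_div_cancel hp₀.ne', NNReal.rpow_one]
  have hκ0 : 0 < K' * E * C₃ * μ := by positivity
  have key : varNorm p v ≤ ((K' * E * C₃ * μ : ℝ≥0) : ℝ≥0∞) := by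
    refine varNorm_le_of_modular hκ0 ?_
    have hpt : ∀ᵐ x, (v x / ((K' * E * C₃ * μ : ℝ≥0) : ℝ≥0∞)) ^ p x ≤
        2⁻¹ * (S.indicator u x / μ) ^ p x + 2⁻¹ * (W x / ν) ^ (p x / p₀) := by
      filter_upwards [hp.ae_lt] with x hpx
      have hhalf : ((E : ℝ≥0∞)⁻¹) ^ p x ≤ 2⁻¹ := by
        have e1 : ((E : ℝ≥0∞)⁻¹) = (2⁻¹ : ℝ≥0∞) ^ (1 / p₀) := by
          rw [hE, ENNReal.coe_rpow_of_nonneg _ (by positivity), ENNReal.inv_rpow]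
          rfl
        rw [e1, ← ENNReal.rpow_mul]
        have e2 : (1 : ℝ) ≤ 1 / p₀ * p x := by
          rw [one_div_mul_eq_div, le_div_iff₀ hp₀]; linarith
        calc (2⁻¹ : ℝ≥0∞) ^ (1 / p₀ * p x) ≤ (2⁻¹ : ℝ≥0∞) ^ (1 : ℝ) :=
              ENNReal.rpow_le_rpow_of_exponent_ge (by simp) e2
          _ = 2⁻¹ := ENNReal.rpow_one _
      have hK'e : ENNReal.ofReal K = K' := rfl
      have hKne : (K' : ℝ≥0∞) ≠ 0 := by exact_mod_cast hK'0.ne'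
      have hEne : (E : ℝ≥0∞) ≠ 0 := by exact_mod_cast hE0.ne'
      have hCne : (C₃ : ℝ≥0∞) ≠ 0 := by exact_mod_cast hC₃0.ne'
      have hμne : (μ : ℝ≥0∞) ≠ 0 := by exact_mod_cast hμ.ne'
      have hsplit : ∀ a w : ℝ≥0∞, v x ≤ K' * a → a / (C₃ * μ) ≤ w →
          (v x / ((K' * E * C₃ * μ : ℝ≥0) : ℝ≥0∞)) ^ p x ≤ 2⁻¹ * w ^ p x := by
        intro a w ha hw
        have h1 : v x / ((K' * E * C₃ * μ : ℝ≥0) : ℝ≥0∞) ≤ (E : ℝ≥0∞)⁻¹ * w := by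
          refine ENNReal.div_le_of_le_mul (ha.trans ?_)
          have h2 := (ENNReal.div_le_iff (mul_ne_zero hCne hμne)
            (ENNReal.mul_ne_top ENNReal.coe_ne_top ENNReal.coe_ne_top)).1 hw
          push_cast
          calc (K' : ℝ≥0∞) * a ≤ K' * (w * (C₃ * μ)) := mul_le_mul_right h2 _
            _ = ((E : ℝ≥0∞)⁻¹ * E) * (K' * (w * (C₃ * μ))) := by
              rw [ENNReal.inv_mul_cancel hEne ENNReal.coe_ne_top, one_mul]
            _ = _ := by ring
        refine (ENNReal.rpow_le_rpow h1 (hp.pos x).le).trans ?_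
        rw [ENNReal.mul_rpow_of_nonneg _ _ (hp.pos x).le]
        exact mul_le_mul_left hhalf _
      by_cases hx : x ∈ S
      · refine le_trans (hsplit (u x) (S.indicator u x / μ) (hv1 x hx) ?_) le_self_add
        rw [indicator_of_mem hx]
        refine ENNReal.div_le_div_left ?_ _
        refine le_mul_of_one_le_left zero_le ?_
        exact_mod_cast hC₃1
      · have hWx := le_hlMax_indicator_cube hn hℓ hx
        have h1 : v x ≤ K' * (L * W x ^ (1 / p₀)) := by
          refine (hv2 x hx).trans ?_
          rw [ENNReal.ofReal_mul (by positivity), ENNReal.ofReal_mul hK.le, mul_assoc]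
          refine mul_le_mul_right (mul_le_mul_right ?_ _) _
          refine le_trans ?_ (ENNReal.rpow_le_rpow hWx (by positivity))
          set ρ : ℝ := ‖x - z‖ with hρ
          have hρ4 : 4 * n * ℓ < ρ := by
            by_contra h
            refine hx (closedBall_subset_cube z (r := 4 * n * ℓ) (by linarith) ?_)
            rw [Metric.mem_closedBall, dist_eq_norm]
            exact not_lt.1 h
          have hρ0 : 0 < ρ := lt_trans (by positivity) hρ4
          have hs0 : 0 < ℓ / ρ := by positivity
          have hs1 : ℓ / ρ ≤ 1 := by
            rw [div_le_one hρ0]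
            nlinarith
          rw [ENNReal.ofReal_rpow_of_pos (by positivity)]
          refine ENNReal.ofReal_le_ofReal ?_
          rw [← Real.rpow_natCast, ← Real.rpow_natCast, ← Real.rpow_mul hs0.le]
          refine Real.rpow_le_rpow_of_exponent_ge hs0 hs1 ?_
          push_cast
          rw [mul_one_div]
          exact hd
        refine le_trans (hsplit _ ((W x / ν) ^ (1 / p₀)) h1 ?_) ?_
        · have hν0 : 0 < ν := by positivity
          rw [ENNReal.div_rpow_of_nonneg _ _ (by positivity),
            ← ENNReal.coe_rpow_of_nonneg _ (by positivity), hνp]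
          push_cast
          rw [ENNReal.coe_div hL0.ne']
          have hLne : (L : ℝ≥0∞) ≠ 0 := by exact_mod_cast hL0.ne'
          rw [ENNReal.div_le_iff (mul_ne_zero hCne hμne)
            (ENNReal.mul_ne_top ENNReal.coe_ne_top ENNReal.coe_ne_top)]
          have e2 : (C₃ : ℝ≥0∞) * (μ / L) * L = C₃ * μ := by
            rw [mul_assoc, ENNReal.div_mul_cancel hLne ENNReal.coe_ne_top]
          rw [← e2]
          have hX0 : (C₃ : ℝ≥0∞) * (μ / L) ≠ 0 :=
            mul_ne_zero hCne (ENNReal.div_ne_zero.2 ⟨hμne, ENNReal.coe_ne_top⟩)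
          have hXt : (C₃ : ℝ≥0∞) * (μ / L) ≠ ⊤ :=
            ENNReal.mul_ne_top ENNReal.coe_ne_top (ENNReal.div_ne_top ENNReal.coe_ne_top hLne)
          rw [← mul_assoc, ENNReal.div_mul_cancel hX0 hXt, mul_comm]
        · rw [← ENNReal.rpow_mul, one_div_mul_eq_div]
          exact le_add_self
    refine (lintegral_mono_ae hpt).trans ?_
    -- Measurability of one summand suffices to split the integral, so none is needed for the
    -- Hardy–Littlewood maximal function.
    have hmeas : AEMeasurable (fun x => 2⁻¹ * (S.indicator u x / μ) ^ p x) volume := by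
      refine AEMeasurable.const_mul ?_ _
      exact AEMeasurable.pow (((hum.indicator (measurableSet_cube _ _)).div_const _).aemeasurable)
        hp.aemeasurable
    rw [lintegral_add_left' hmeas, lintegral_const_mul' _ _ (by simp),
      lintegral_const_mul' _ _ (by simp)]
    calc _ ≤ (2⁻¹ : ℝ≥0∞) * 1 + 2⁻¹ * 1 :=
          add_le_add (mul_le_mul_right hmod _) (mul_le_mul_right hWn _)
      _ = 1 := by rw [mul_one, ENNReal.inv_two_add_inv_two]
  refine key.trans (le_of_eq ?_)
  push_cast
  ring

end VariableNorm

end VarHardy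

/-! ### The decomposition -/

theorem theorem5p1 (n : ℕ) (hn : 1 ≤ n) :
    -- the bound for the overlap depends on the dimension only
    ∃ A : ℕ, ∀ (p : VarHardy.Rn n → ℝ) (p₀ : ℝ), VarHardy.IsMP0 p p₀ →
      ∀ N : ℕ, (n : ℝ) / p₀ + n + 1 < N →
      -- `c` and `C` depend on `n`, `p`, `p₀`, `N`, and `C` also on `Φ`
      ∃ (c : ℝ≥0) (C : 𝓢(VarHardy.Rn n, ℂ) → ℝ≥0),
        ∀ (F : 𝓢'(VarHardy.Rn n, ℂ)) (f : VarHardy.Rn n → ℂ),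
          VarHardy.IsLocIntegrableRep F f → VarHardy.MemHardy p N F →
        ∀ lam : ℝ, 0 < lam →
        ∃ (ι : Type) (_ : Countable ι) (z : ι → VarHardy.Rn n) (ℓ : ι → ℝ)
          (g : VarHardy.Rn n → ℂ) (b : ι → VarHardy.Rn n → ℂ)
          (hb : ∀ k, Integrable (b k) volume),
          -- the cubes
          (∀ k, 0 < ℓ k) ∧
          {x | ENNReal.ofReal lam < VarHardy.grandMax N F x} =
            ⋃ k, VarHardy.cube (z k) (ℓ k) ∧
          (∀ x, {k | x ∈ VarHardy.cube (z k) (ℓ k)}.encard ≤ A) ∧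
          -- the decomposition `f = g + ∑ b_k`, almost everywhere and locally in `L¹`
          (∀ᵐ x, HasSum (fun k => b k x) (f x - g x)) ∧
          (∀ K : Set (VarHardy.Rn n), IsCompact K →
            Summable (fun k => ∫ x in K, ‖b k x‖)) ∧
          -- the good part
          AEStronglyMeasurable g volume ∧
          (∀ x, ‖g x‖ ≤ c * lam) ∧
          -- the bad parts
          (∀ k, tsupport (b k) ⊆ VarHardy.cube (z k) (ℓ k)) ∧
          (∀ k, ∀ α : Fin n → ℕ,
            ((∑ i, α i : ℕ) : ℤ) ≤ max 0 ⌊(n : ℝ) * (1 / p₀ - 1)⌋ →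
            ∫ x, b k x * ((∏ i, x i ^ α i : ℝ) : ℂ) = 0) ∧
          (∀ k, ∀ Φ : 𝓢(VarHardy.Rn n, ℂ),
            VarHardy.varNorm p (VarHardy.radialMax Φ (VarHardy.distOf (hb k))) ≤
              C Φ * VarHardy.varNorm p
                ((VarHardy.cube (z k) (ℓ k)).indicator (VarHardy.grandMax N F))) := by

  have hn1 : (1 : ℝ) ≤ n := by exact_mod_cast hn
  obtain ⟨A, hA⟩ := VarHardy.exists_whitney hn
  refine ⟨A, fun p p₀ hp N hN => ?_⟩
  have hp₀ := hp.p0_pos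
  set d : ℕ := (max 0 ⌊(n : ℝ) * (1 / p₀ - 1)⌋).toNat with hd
  have hdz : (d : ℤ) = max 0 ⌊(n : ℝ) * (1 / p₀ - 1)⌋ := Int.toNat_of_nonneg (le_max_left _ _)
  have hnp : (n : ℝ) * (1 / p₀ - 1) = n / p₀ - n := by ring
  have hnp0 : 0 < (n : ℝ) / p₀ := by positivity
  have hdN : d < N := by
    have h1 : (d : ℝ) ≤ n / p₀ := by
      have h2 : (d : ℝ) = ((max 0 ⌊(n : ℝ) * (1 / p₀ - 1)⌋ : ℤ) : ℝ) := by
        exact_mod_cast congrArg (Int.cast : ℤ → ℝ) hdz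
      rw [h2, Int.cast_max]
      refine max_le (by simpa using hnp0.le) ((Int.floor_le _).trans ?_)
      rw [hnp]; linarith
    have h3 : (d : ℝ) < N := by linarith
    exact_mod_cast h3
  -- The far decay exponent n + d + 1 reaches n/p₀, because ⌊n/p₀ − n⌋ + 1 exceeds n/p₀ − n.
  have hdn : (n : ℝ) / p₀ ≤ n + d + 1 := by
    have h1 : (⌊(n : ℝ) * (1 / p₀ - 1)⌋ : ℤ) ≤ (d : ℤ) := by rw [hdz]; exact le_max_right _ _
    have h2 : ((⌊(n : ℝ) * (1 / p₀ - 1)⌋ : ℤ) : ℝ) ≤ d := by exact_mod_cast h1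
    have h3 := Int.lt_floor_add_one ((n : ℝ) * (1 / p₀ - 1))
    rw [hnp] at h2 h3
    linarith
  obtain ⟨B, hB, hpart⟩ := VarHardy.exists_partition (n := n) hn N A
  obtain ⟨C₁, hC₁, hcorr⟩ := VarHardy.exists_moment_correction n N d hB
  choose Cn hCn hnear using fun Φ => VarHardy.exists_enorm_near_le n N hB hC₁ Φ
  choose Cf hCf hfar using fun Φ => VarHardy.exists_enorm_far_le hn hdN hB hC₁ Φ
  obtain ⟨Cg, hCg, hgm⟩ := VarHardy.exists_enorm_le_grandMax n N
  choose C hC using fun Φ => VarHardy.exists_varNorm_le hn hp hdn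
    (add_pos (hCn Φ) (hCf Φ))
  refine ⟨(Cg + A * C₁).toNNReal, C, ?_⟩
  intro F f hF hH lam hlam
  have hcge : ((Cg + A * C₁).toNNReal : ℝ) = Cg + A * C₁ := Real.coe_toNNReal _ (by positivity)
  set Ω : Set (VarHardy.Rn n) := {x | ENNReal.ofReal lam < VarHardy.grandMax N F x} with hΩ
  have hΩo : IsOpen Ω := VarHardy.isOpen_lt_grandMax N F _
  have hΩv : volume Ω < ⊤ :=
    VarHardy.volume_lt_top_of_varNorm_lt_top hp.toIsExponent hH hlam hΩo.measurableSet
  have hne : (Ωᶜ).Nonempty := by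
    rw [nonempty_compl]
    intro h
    have : Nonempty (Fin n) := ⟨⟨0, hn⟩⟩
    have : Nontrivial (VarHardy.Rn n) := inferInstance
    rw [h, measure_univ_of_isAddLeftInvariant] at hΩv
    exact lt_irrefl _ hΩv
  obtain ⟨ι, hι, z, ℓ, hℓ, h8, h40, hcov, hov⟩ := hA Ω hΩo hne
  have hballcube : ∀ k, Metric.closedBall (z k) (2 * n * ℓ k) ⊆
      VarHardy.cube (z k) (8 * n * ℓ k) := fun k =>
    VarHardy.closedBall_subset_cube _ (by
      have := mul_pos (zero_lt_one.trans_le hn1) (hℓ k)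
      linarith)
  have hsmall : ∀ k, VarHardy.cube (z k) (ℓ k) ⊆ VarHardy.cube (z k) (8 * n * ℓ k) :=
    fun k y hy i => (hy i).trans (by
      have := mul_le_mul_of_nonneg_right hn1 (hℓ k).le
      linarith [hℓ k])
  have hcubeΩ : ∀ k, VarHardy.cube (z k) (8 * n * ℓ k) ⊆ Ω := by
    intro k x hx
    by_contra hxΩ
    have h1 := VarHardy.norm_sub_le_of_mem_cube (by have := hℓ k; positivity) hx
    have h2 : Metric.infDist (z k) Ωᶜ ≤ dist (z k) x := Metric.infDist_le_dist_of_mem hxΩ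
    rw [dist_comm, dist_eq_norm] at h2
    have h3 := h8 k
    have h4 : 0 < (n : ℝ) ^ 2 * ℓ k := by have := hℓ k; positivity
    nlinarith
  -- The distances to the complement give 8ℓ_k ≤ 40ℓ_j + 2ℓ_j + 2ℓ_k, so ℓ_k ≤ 7ℓ_j; 16 leaves room.
  have hcomp : ∀ j k y, y ∈ Metric.closedBall (z j) (2 * n * ℓ j) →
      y ∈ Metric.closedBall (z k) (2 * n * ℓ k) → ℓ k ≤ 16 * ℓ j := by
    intro j k y hj hk
    rw [Metric.mem_closedBall] at hj hk
    have h1 : Metric.infDist y Ωᶜ ≤ Metric.infDist (z j) Ωᶜ + dist y (z j) :=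
      Metric.infDist_le_infDist_add_dist
    have h2 : Metric.infDist (z k) Ωᶜ ≤ Metric.infDist y Ωᶜ + dist (z k) y :=
      Metric.infDist_le_infDist_add_dist
    rw [dist_comm (z k)] at h2
    have h3 := h8 k
    have h4 := h40 j
    have hnn : (n : ℝ) ≤ (n : ℝ) ^ 2 := by nlinarith
    have h5 := mul_le_mul_of_nonneg_right hnn (hℓ k).le
    have h6 := mul_le_mul_of_nonneg_right hnn (hℓ j).le
    have h7 : (n : ℝ) ^ 2 * ℓ k ≤ (n : ℝ) ^ 2 * (16 * ℓ j) := by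
      have : 0 < (n : ℝ) ^ 2 * ℓ j := by have := hℓ j; positivity
      nlinarith
    exact le_of_mul_le_mul_left h7 (by positivity)
  obtain ⟨η, hηs, hηt, hηb, hη1⟩ := hpart ι z ℓ hℓ
    (fun x => (encard_le_encard fun k hk => hballcube k hk).trans (hov x)) hcomp
  have hx₀ : ∀ k, ∃ x₀ : VarHardy.Rn n, ‖x₀ - z k‖ ≤ 40 * (n : ℝ) ^ 2 * ℓ k ∧
      VarHardy.grandMax N F x₀ ≤ ENNReal.ofReal lam := by
    intro k
    obtain ⟨x₀, hx₀, hd₀⟩ := (Metric.infDist_lt_iff hne).1 (h40 k)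
    refine ⟨x₀, ?_, not_lt.1 hx₀⟩
    rw [← dist_eq_norm, dist_comm]
    exact hd₀.le
  choose x₀ hx₀d hx₀M using hx₀
  choose Q hQm hQb hQs hQi using fun k => hcorr F f hF (z k) (x₀ k) (ℓ k) lam (η k) (hℓ k) hlam
    (hηs k) (hηt k) (hηb k) (hx₀d k) (hx₀M k)
  have hηc : ∀ k, HasCompactSupport (η k) := fun k =>
    HasCompactSupport.of_support_subset_isCompact
      (isCompact_closedBall (z k) (2 * n * ℓ k)) (subset_closure.trans (hηt k))
  have hη0 : ∀ k x, x ∉ VarHardy.cube (z k) (8 * n * ℓ k) → η k x = 0 := by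
    intro k x hx
    by_contra h
    exact hx (hballcube k (hηt k (subset_tsupport _ h)))
  have hQ0 : ∀ k x, x ∉ VarHardy.cube (z k) (8 * n * ℓ k) → Q k x = 0 :=
    fun k x hx => hQs k x fun h => hx (hsmall k h)
  set b : ι → VarHardy.Rn n → ℂ := fun k y => η k y * f y - Q k y with hbdef
  have hb0 : ∀ k x, x ∉ VarHardy.cube (z k) (8 * n * ℓ k) → b k x = 0 := by
    intro k x hx
    simp only [hbdef, hη0 k x hx, hQ0 k x hx, zero_mul, sub_zero]
  have hbint : ∀ k (q : VarHardy.Rn n → ℂ), Continuous q →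
      Integrable (fun y => b k y * q y) := by
    intro k q hq
    have := (VarHardy.integrable_mul_mul_of_tsupport hF.1 (hηs k).continuous (hηc k) hq).sub
      (VarHardy.integrable_mul_of_bounded_of_compact (hQm k) (hQb k)
        (VarHardy.isCompact_cube (z k) (hℓ k).le) (hQs k) hq)
    refine this.congr (Filter.Eventually.of_forall fun y => ?_)
    simp only [Pi.sub_apply, hbdef]
    ring
  have hbi : ∀ k, Integrable (b k) volume := fun k => by
    simpa using hbint k (fun _ => 1) continuous_const
  have hfin : ∀ x, {k | x ∈ VarHardy.cube (z k) (8 * n * ℓ k)}.Finite := fun x =>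
    Set.finite_of_encard_le_coe (hov x)
  have hcard : ∀ x, (hfin x).toFinset.card ≤ A := by
    intro x
    have := hov x
    rw [(hfin x).encard_eq_coe_toFinset_card] at this
    exact_mod_cast this
  have hnot : ∀ x k, k ∉ (hfin x).toFinset → x ∉ VarHardy.cube (z k) (8 * n * ℓ k) := by
    intro x k hk
    simpa using hk
  have hQsum : ∀ x, HasSum (fun k => Q k x) (∑' k, Q k x) := fun x =>
    (summable_of_ne_finset_zero (s := (hfin x).toFinset)
      fun k hk => hQ0 k x (hnot x k hk)).hasSum
  have hQtsum : ∀ x, ‖∑' k, Q k x‖ ≤ A * (C₁ * lam) := by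
    intro x
    rw [tsum_eq_sum (s := (hfin x).toFinset) fun k hk => hQ0 k x (hnot x k hk)]
    refine (norm_sum_le_of_le _ fun k _ => hQb k x).trans ?_
    rw [Finset.sum_const, nsmul_eq_mul]
    have : ((hfin x).toFinset.card : ℝ) ≤ A := by exact_mod_cast hcard x
    gcongr
  set g₀ : VarHardy.Rn n → ℂ := fun x => Ωᶜ.indicator f x + ∑' k, Q k x with hg₀
  have hg₀m : AEStronglyMeasurable g₀ volume :=
    (hF.1.aestronglyMeasurable.indicator hΩo.measurableSet.compl).add
      (Measurable.tsum fun k => hQm k).aestronglyMeasurable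
  have hg₀b : ∀ᵐ x, ‖g₀ x‖ ≤ (Cg + A * C₁) * lam := by
    filter_upwards [hgm F f hF] with x hx
    have h1 : ‖Ωᶜ.indicator f x‖ ≤ Cg * lam := by
      by_cases hxΩ : x ∈ Ωᶜ
      · rw [indicator_of_mem hxΩ]
        have h2 := hx.trans (mul_le_mul_right
          (not_lt.1 (show ¬ENNReal.ofReal lam < VarHardy.grandMax N F x from hxΩ)) _)
        rw [← ENNReal.ofReal_mul hCg.le, ← ofReal_norm,
          ENNReal.ofReal_le_ofReal_iff (by positivity)] at h2
        exact h2
      · rw [indicator_of_notMem hxΩ, norm_zero]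
        positivity
    refine (norm_add_le _ _).trans ?_
    have := hQtsum x
    linarith
  -- The bound for g is asked at every point, so `g₀` is replaced by zero on the null set where it
  -- fails.
  set g : VarHardy.Rn n → ℂ := {x | ‖g₀ x‖ ≤ (Cg + A * C₁) * lam}.indicator g₀ with hg
  have hgg₀ : g =ᵐ[volume] g₀ := by
    filter_upwards [hg₀b] with x hx
    exact indicator_of_mem (s := {x | ‖g₀ x‖ ≤ (Cg + A * C₁) * lam}) hx _
  refine ⟨ι, hι, z, fun k => 8 * n * ℓ k, g, b, hbi, fun k => by have := hℓ k; positivity,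
    ?_, hov, ?_, ?_, hg₀m.congr hgg₀.symm, ?_, ?_, ?_, ?_⟩
  · refine Subset.antisymm (fun x hx => ?_) (iUnion_subset hcubeΩ)
    obtain ⟨k, hk⟩ := hcov x hx
    refine mem_iUnion.2 ⟨k, hballcube k (Metric.closedBall_subset_closedBall ?_ hk)⟩
    have := mul_pos (zero_lt_one.trans_le hn1) (hℓ k)
    linarith
  · filter_upwards [hgg₀] with x hx
    rw [hx]
    by_cases hxΩ : x ∈ Ω
    · have h1 := ((hη1 x (hcov x hxΩ)).mul_right (f x)).sub (hQsum x)
      have h2 : Ωᶜ.indicator f x = 0 := indicator_of_notMem (Set.notMem_compl_iff.2 hxΩ) _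
      rw [one_mul] at h1
      simp only [hg₀, h2, zero_add]
      exact h1
    · have h1 : ∀ k, x ∉ VarHardy.cube (z k) (8 * n * ℓ k) := fun k h => hxΩ (hcubeΩ k h)
      have h2 : Ωᶜ.indicator f x = f x := indicator_of_mem hxΩ _
      have h3 : ∀ k, Q k x = 0 := fun k => hQ0 k x (h1 k)
      have h4 : ∀ k, b k x = 0 := fun k => hb0 k x (h1 k)
      simp only [hg₀, h2, h3, h4, tsum_zero, add_zero, sub_self]
      exact hasSum_zero
  · intro K hK
    -- At each point at most `A` bad parts are nonzero, each at most B|f| + C₁λ, so this function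
    -- dominates all finite sums of their norms.
    have hfK : IntegrableOn (fun x => (A : ℝ) * (B * ‖f x‖ + C₁ * lam)) K volume := by
      have h1 : IntegrableOn f K volume := hF.1.integrableOn_isCompact hK
      refine Integrable.const_mul ((h1.norm.const_mul B).add ?_) _
      exact integrableOn_const hK.measure_lt_top.ne
    refine summable_of_sum_le (c := ∫ x in K, (A : ℝ) * (B * ‖f x‖ + C₁ * lam))
      (fun k => integral_nonneg fun _ => norm_nonneg _) fun s => ?_
    rw [← integral_finsetSum _ fun k _ => (hbi k).norm.integrableOn]
    refine integral_mono (integrable_finsetSum _ fun k _ => (hbi k).norm.integrableOn) hfK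
      fun x => ?_
    have h1 : ∀ k, ‖b k x‖ ≤ B * ‖f x‖ + C₁ * lam := by
      intro k
      refine (norm_sub_le _ _).trans (add_le_add ?_ (hQb k x))
      rw [norm_mul]
      exact mul_le_mul_of_nonneg_right (hηb k x).norm_le (norm_nonneg _)
    have h2 : ∑ k ∈ s, ‖b k x‖ ≤ ∑ k ∈ (hfin x).toFinset, ‖b k x‖ := by
      classical
      rw [← Finset.sum_filter_add_sum_filter_not s (fun k => k ∈ (hfin x).toFinset)]
      have h3 : ∑ k ∈ s with k ∉ (hfin x).toFinset, ‖b k x‖ = 0 :=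
        Finset.sum_eq_zero fun k hk => by
          rw [hb0 k x (hnot x k (Finset.mem_filter.1 hk).2), norm_zero]
      rw [h3, add_zero]
      exact Finset.sum_le_sum_of_subset_of_nonneg
        (fun k hk => (Finset.mem_filter.1 hk).2) fun _ _ _ => norm_nonneg _
    refine h2.trans ((Finset.sum_le_sum fun k _ => h1 k).trans ?_)
    rw [Finset.sum_const, nsmul_eq_mul]
    have : ((hfin x).toFinset.card : ℝ) ≤ A := by exact_mod_cast hcard x
    gcongr
  · intro x
    rw [hcge]
    by_cases hx : ‖g₀ x‖ ≤ (Cg + A * C₁) * lam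
    · have : g x = g₀ x := indicator_of_mem (s := {x | ‖g₀ x‖ ≤ (Cg + A * C₁) * lam}) hx _
      rw [this]
      exact hx
    · have : g x = 0 := indicator_of_notMem (s := {x | ‖g₀ x‖ ≤ (Cg + A * C₁) * lam}) hx _
      rw [this, norm_zero]
      positivity
  · intro k
    refine closure_minimal (fun x hx => ?_) (VarHardy.isClosed_cube _ _)
    by_contra h
    exact hx (hb0 k x h)
  · intro k α hα
    refine VarHardy.integral_mul_monomial_eq_zero (hℓ k) (d := d) (hbint k) (hQi k) α ?_
    rw [← hdz] at hα
    exact_mod_cast hα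
  · intro k Φ
    refine hC Φ (z k) (ℓ k) lam (VarHardy.grandMax N F) _ (hℓ k) hlam
      (VarHardy.measurable_grandMax N F) (fun x hx => (hcubeΩ k hx).le) ?_ ?_
    · intro x hx
      refine iSup_le fun t => ?_
      rw [VarHardy.distOf_apply]
      refine (hnear Φ F f hF (z k) (ℓ k) lam (η k) (Q k) (hℓ k) hlam (hηs k) (hηt k) (hηb k)
        (hQm k) (hQb k) (hQs k) x hx (hcubeΩ k hx) t).trans ?_
      exact mul_le_mul_left (ENNReal.ofReal_le_ofReal (by linarith [hCf Φ])) _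
    · intro x hx
      refine iSup_le fun t => ?_
      rw [VarHardy.distOf_apply]
      refine (hfar Φ F f hF (z k) (x₀ k) (ℓ k) lam (η k) (Q k) (hℓ k) hlam (hηs k) (hηt k)
        (hηb k) (hx₀d k) (hx₀M k) (hQm k) (hQb k) (hQs k) (hQi k) x hx t).trans ?_
      refine ENNReal.ofReal_le_ofReal ?_
      have := hCn Φ
      have := hℓ k
      gcongr
      linarith
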